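/- Let $M$ be a smooth (Hausdorff, $\sigma$-compact) manifold and let $A\to M$ be a real Lie algebroid of rank $N$, with anchor $\rho$, bracket $[\cdot,\cdot]_A$, Lie algebroid differential $d_A$ on $\Gamma(\wedge^\bullet A^*)$ and Lie derivations $\mathcal L_x=[i_x,d_A]$ $(x\in\Gamma A)$. Extend $[\cdot,\cdot]_A$ to the Gerstenhaber (Schouten) bracket of $\Gamma(\wedge^\bullet A)$. For $\pi\in\Gamma(\wedge^2A)$ let $\pi^\sharp:A^*\to A$ be defined by $\langle\beta,\pi^\sharp\alpha\rangle=\pi(\alpha,\beta)$. Interior products by bivectors are normalized by $i_{x\wedge y}=i_x\circ i_y$. Let $(\pi,\psi)$, with $\psi\in\Gamma(\wedge^3A^*)$, be a twisted Poisson structure on $A$, i.e. $$\tfrac12[\pi,\pi]_A=(\wedge^3\pi^\sharp)\psi,\qquad d_A\psi=0 .$$ Equip $A^*$ with the anchor $\rho\circ\pi^\sharp$ and the bracket $$[\alpha,\beta]_{\pi,\psi}=\mathcal L_{\pi^\sharp\alpha}\beta-\mathcal L_{\pi^\sharp\beta}\alpha-d_A(\pi(\alpha,\beta))+\psi(\pi^\sharp\alpha,\pi^\sharp\beta,\cdot\,),$$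 and let $d_{\pi,\psi}$ be the associated differential on $\Gamma(\wedge^\bullet A)$. Let $\psi^{(2)}\in\Gamma(\wedge^2A\otimes A^*)$ be defined by $\psi^{(2)}(\alpha,\beta)=\psi(\pi^\sharp\alpha,\pi^\sharp\beta,\cdot\,)\in\Gamma A^*$, and let $Y_{\pi,\psi}\in\Gamma A$ be the section such that $$\langle\alpha,Y_{\pi,\psi}\rangle=\tfrac12\operatorname{Tr}\bigl(\beta\mapsto\psi^{(2)}(\alpha,\beta)\bigr),$$ that is, $Y_{\pi,\psi}=\pi^\sharp\langle\pi,\psi\rangle$, where $\langle\pi,\psi\rangle=\sum_k\psi(x_k,y_k,\cdot\,)$ if $\pi=\sum_k x_k\wedge y_k$. On $\Gamma(\wedge^\bullet A^*)$ let $$\partial=\partial_\pi+\underline\partial_{\pi,\psi}+i_{Y_{\pi,\psi}},\qquad \partial_\pi=d_A i_\pi-i_\pi d_A,$$ where $\underline\partial_{\pi,\psi}$ is the interior product by $\psi^{(2)}$, with $i_{\xi\otimes P}\eta=\xi\wedge i_P\eta$ for $\xi\in\Gamma A^*$, $P\in\Gamma(\wedge^2A)$. For a nowhere vanishing section $\lambda$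 of $\wedge^NA^*$, or a nowhere vanishing density (in the non-orientable case), let $X_{\pi,\lambda}\in\Gamma A$ be defined by $$\langle\alpha,X_{\pi,\lambda}\rangle\lambda=\mathcal L_{\pi^\sharp\alpha}\lambda-(i_\pi d_A\alpha)\lambda\qquad(\alpha\in\Gamma A^*),$$ and set $Z_{\pi,\psi,\lambda}=X_{\pi,\lambda}+Y_{\pi,\psi}$. The modular class of $(A,\pi,\psi)$ is the class of $Z_{\pi,\psi,\lambda}$ in the first cohomology space of $(\Gamma(\wedge^\bullet A),d_{\pi,\psi})$, for any such $\lambda$. For a representation $D$ of a Lie algebroid $E$ on a line bundle $L$ with a nowhere vanishing section $s$, the characteristic class of $E$ associated to $D$ is the class of the $d_E$-cocycle $\theta\in\Gamma(E^*)$ with $D_xs=\langle\theta,x\rangle s$; if $L$ is not trivial, it is one half of the class associated to the induced representation on $L\otimes L$. **Proposition.** The anchor and bracket above make $A^*$ a Lie algebroid; the formula $D^\partial_\alpha\mu=-\alpha\wedge\partial\mu$ $(\alpha\in\Gamma A^*,\ \mu\in\Gamma(\wedge^NA^*))$ defines a representation $D^\partial$ of this Lie algebroid on $\wedge^NA^*$;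 the sections $Z_{\pi,\psi,\lambda}$ are $d_{\pi,\psi}$-closed and their class does not depend on $\lambda$; and the characteristic class of $A^*$ associated to the representation $D^\partial$ coincides with the modular class of $(A,\pi,\psi)$. -/

import Mathlib

open scoped Manifold ContDiff TensorProduct

namespace TwistedPoisson

/-- A Lie algebroid, described on its `C^∞(M)`-module of sections `S` (with `C = C^∞(M)`):
a `C`-linear anchor into vector fields (derivations of `C`) and a Lie bracket of sections
satisfying the Leibniz rule, the anchor being a morphism of Lie algebras. -/
structure LieAlgebroid (C S : Type*) [CommRing C] [Algebra ℝ C] [AddCommGroup S] [Module C S] where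
  anchor : S →ₗ[C] Derivation ℝ C C
  bracket : S →+ S →+ S
  bracket_self : ∀ a, bracket a a = 0
  jacobi : ∀ a b c, bracket a (bracket b c) = bracket (bracket a b) c + bracket b (bracket a c)
  leibniz : ∀ a b (f : C), bracket a (f • b) = f • bracket a b + anchor a f • b
  anchor_bracket : ∀ a b, anchor (bracket a b) = ⁅anchor a, anchor b⁆

/-- Sections of `∧^q A^*`, as `C`-multilinear alternating maps on the module `S` of sections of
`A`. Sections of `∧^p A` are elements of the exterior power `⋀[C]^p S`, and sections of `A^*` are
elements of `Module.Dual C S`. -/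
abbrev Form (C S : Type*) [CommRing C] [AddCommGroup S] [Module C S] (q : ℕ) : Type _ :=
  S [⋀^Fin q]→ₗ[C] C

namespace LieAlgebroid
section
variable {C S : Type*} [CommRing C] [Algebra ℝ C] [AddCommGroup S] [Module C S]
  (E : LieAlgebroid C S)

lemma bracket_neg_swap (a b : S) : E.bracket a b = - E.bracket b a := by
  have h := E.bracket_self (a + b)
  simp only [map_add, AddMonoidHom.add_apply, E.bracket_self, zero_add, add_zero] at h
  rw [eq_neg_iff_add_eq_zero, add_comm]; exact h

lemma bracket_smul_left (f : C) (a b : S) :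
    E.bracket (f • a) b = f • E.bracket a b - E.anchor b f • a := by
  rw [E.bracket_neg_swap, E.leibniz, E.bracket_neg_swap b a]
  simp only [smul_neg]; abel

/-- The value of the Lie algebroid differential `d_A η` of a `q`-form on sections `a₀, …, a_q`:
`∑ (-1)^k ρ(a_k)(η(…, â_k, …)) + ∑_{k < l} (-1)^{k + l} η([a_k, a_l], …, â_k, …, â_l, …)`.
A pair of indices `k < l` in `Fin (q + 2)` is written as `k.castSucc`, `l.succ` with `k ≤ l`. -/
def koszul : ∀ {q : ℕ}, Form C S q → (Fin (q + 1) → S) → C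
  | 0, η, a => E.anchor (a 0) (η ![])
  | q + 1, η, a =>
      ∑ k : Fin (q + 2), (-1) ^ (k : ℕ) * E.anchor (a k) (η (k.removeNth a)) +
      ∑ k : Fin (q + 1), ∑ l ≥ k, (-1) ^ ((k : ℕ) + (l + 1)) *
        η (Matrix.vecCons (E.bracket (a k.castSucc) (a l.succ))
          (l.removeNth (k.castSucc.removeNth a)))

/-- A form, seen as a `ℤ`-multilinear alternating map. -/
def intAlt {q : ℕ} (η : Form C S q) : S [⋀^Fin q]→ₗ[ℤ] C :=
  { η.toMultilinearMap.restrictScalars ℤ with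
    map_eq_zero_of_eq' := η.map_eq_zero_of_eq' }

lemma intAlt_apply {q : ℕ} (η : Form C S q) (a) : intAlt η a = η a := rfl

/-- A `ℤ`-multilinear alternating map which is twice the Koszul expression. -/
lemma exists_intAlt : ∀ {q : ℕ} (η : Form C S q),
    ∃ K : S [⋀^Fin (q + 1)]→ₗ[ℤ] C, ∀ a, K a = 2 * E.koszul η a := by
  have h1 : ∀ {q : ℕ} (η : Form C S q), ∃ K : S [⋀^Fin (q + 1)]→ₗ[ℤ] C, ∀ a,
      K a = ∑ k : Fin (q + 1), (-1) ^ (k : ℕ) * E.anchor (a k) (η (k.removeNth a)) := by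
    intro q η
    let f : S →+ (S [⋀^Fin q]→ₗ[ℤ] C) :=
      { toFun := fun x => ((E.anchor x : C →ₗ[ℝ] C).toAddMonoidHom.toIntLinearMap).compAlternatingMap
          (intAlt η)
        map_zero' := by ext; simp
        map_add' := by intros; ext; simp }
    refine ⟨AlternatingMap.alternatizeUncurryFin f.toIntLinearMap, fun a => ?_⟩
    rw [AlternatingMap.alternatizeUncurryFin_apply]
    refine Finset.sum_congr rfl fun k _ => ?_
    rw [zsmul_eq_mul]; push_cast; rfl
  intro q η
  cases q with
  | zero =>
    obtain ⟨K, hK⟩ := h1 η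
    refine ⟨(2 : ℤ) • K, fun a => ?_⟩
    rw [AlternatingMap.smul_apply, hK]
    have e : (0 : Fin 1).removeNth a = ![] := Subsingleton.elim _ _
    rw [Fin.sum_univ_one, e]
    simp [koszul]
  | succ q =>
    obtain ⟨K, hK⟩ := h1 η
    let g : S →+ S →+ (S [⋀^Fin q]→ₗ[ℤ] C) :=
      { toFun := fun x =>
          { toFun := fun y => intAlt (η.curryLeft (E.bracket x y))
            map_zero' := by ext; simp [intAlt_apply]
            map_add' := by intros; ext; simp only [map_add, AlternatingMap.add_apply, intAlt_apply] }
        map_zero' := by ext; simp [intAlt_apply]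
        map_add' := by
          intros; ext
          simp only [map_add, AlternatingMap.add_apply, intAlt_apply, AddMonoidHom.coe_mk,
            ZeroHom.coe_mk, AddMonoidHom.add_apply] }
    let g' : S →ₗ[ℤ] S →ₗ[ℤ] (S [⋀^Fin q]→ₗ[ℤ] C) :=
      AddMonoidHom.toIntLinearMap
        { toFun := fun x => (g x).toIntLinearMap
          map_zero' := by ext; simp
          map_add' := by intros; ext; simp }
    refine ⟨(2 : ℤ) • K - AlternatingMap.alternatizeUncurryFin
      (AlternatingMap.alternatizeUncurryFinLM ∘ₗ g'), fun a => ?_⟩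
    rw [AlternatingMap.sub_apply, AlternatingMap.smul_apply, hK,
      AlternatingMap.alternatizeUncurryFin_alternatizeUncurryFinLM_comp_apply, koszul, mul_add,
      sub_eq_add_neg]
    congr 1
    · simp
    · rw [Finset.mul_sum, ← Finset.sum_neg_distrib]
      refine Finset.sum_congr rfl fun i _ => ?_
      rw [Finset.mul_sum, ← Finset.sum_neg_distrib]
      refine Finset.sum_congr rfl fun j _ => ?_
      have eg : ∀ x y v, g' x y v = η (Matrix.vecCons (E.bracket x y) v) := fun _ _ _ => rfl
      rw [eg, eg, E.bracket_neg_swap (a j.succ)]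
      have e2 : ∀ (x : S) (v : Fin q → S), η (Matrix.vecCons (-x) v) = - η (Matrix.vecCons x v) := by
        intro x v
        have := (η.curryLeft).map_neg x
        exact congrArg (fun F => F v) this
      rw [e2, zsmul_eq_mul]; push_cast; ring

lemma koszul_smul_zero {q : ℕ} (η : Form C S q) (f : C) (x : S) (b : Fin q → S) :
    E.koszul η (Fin.cons (f • x) b) = f * E.koszul η (Fin.cons x b) := by
  have hs : ∀ {r : ℕ} (ζ : Form C S (r + 1)) (y : S) (c : Fin r → S),
      ζ (Fin.cons (f • y) c) = f * ζ (Fin.cons y c) := by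
    intro r ζ y c
    have := congrArg (fun F => F c) ((ζ.curryLeft).map_smul f y)
    exact this
  cases q with
  | zero => simp [koszul]
  | succ r =>
    have c0 : ∀ (y : S), (0 : Fin (r + 2)).removeNth (Fin.cons y b : Fin (r + 2) → S) = b := by
      intro y; rfl
    have c1 : ∀ (y : S) (k : Fin (r + 1)),
        k.succ.removeNth (Fin.cons y b : Fin (r + 2) → S) =
          (Fin.cons y (k.removeNth b) : Fin (r + 1) → S) := by
      intro y k
      funext i
      refine Fin.cases ?_ (fun i => ?_) i
      · simp [Fin.removeNth_apply]
      · simp [Fin.removeNth_apply]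
    have hexp : ∀ a : Fin (r + 2) → S, E.koszul η a =
        ((-1) ^ ((0 : Fin (r + 2)) : ℕ) * E.anchor (a 0) (η ((0 : Fin (r + 2)).removeNth a)) +
          ∑ k : Fin (r + 1), (-1) ^ ((k.succ : Fin (r + 2)) : ℕ) *
            E.anchor (a k.succ) (η (k.succ.removeNth a))) +
        ((∑ l ≥ (0 : Fin (r + 1)), (-1) ^ (((0 : Fin (r + 1)) : ℕ) + (l + 1)) *
            η (Matrix.vecCons (E.bracket (a (Fin.castSucc 0)) (a l.succ))
              (l.removeNth ((Fin.castSucc 0).removeNth a)))) +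
          ∑ k : Fin r, ∑ l ≥ k.succ, (-1) ^ (((k.succ : Fin (r + 1)) : ℕ) + (l + 1)) *
            η (Matrix.vecCons (E.bracket (a k.succ.castSucc) (a l.succ))
              (l.removeNth (k.succ.castSucc.removeNth a)))) := by
      intro a
      exact congrArg₂ (· + ·) (Fin.sum_univ_succ _) (Fin.sum_univ_succ _)
    rw [hexp, hexp]
    have t1 : ∑ k : Fin r, ∑ l ≥ k.succ, (-1 : C) ^ (((k.succ : Fin (r + 1)) : ℕ) + (l + 1)) *
        η (Matrix.vecCons (E.bracket ((Fin.cons (f • x) b : Fin (r + 2) → S) k.succ.castSucc)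
            ((Fin.cons (f • x) b : Fin (r + 2) → S) l.succ))
          (l.removeNth (k.succ.castSucc.removeNth (Fin.cons (f • x) b : Fin (r + 2) → S)))) =
      f * ∑ k : Fin r, ∑ l ≥ k.succ, (-1 : C) ^ (((k.succ : Fin (r + 1)) : ℕ) + (l + 1)) *
        η (Matrix.vecCons (E.bracket ((Fin.cons x b : Fin (r + 2) → S) k.succ.castSucc)
            ((Fin.cons x b : Fin (r + 2) → S) l.succ))
          (l.removeNth (k.succ.castSucc.removeNth (Fin.cons x b : Fin (r + 2) → S)))) := by
      rw [Finset.mul_sum]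
      refine Finset.sum_congr rfl fun k _ => ?_
      rw [Finset.mul_sum]
      refine Finset.sum_congr rfl fun l hl => ?_
      obtain ⟨r', rfl⟩ : ∃ r', r = r' + 1 := ⟨r - 1, by have := k.pos; omega⟩
      obtain ⟨m, rfl⟩ : ∃ m, l = Fin.succ m := by
        refine Fin.exists_succ_eq.2 ?_ |>.imp fun _ h => h.symm
        rintro rfl
        simp at hl
      have d1 : ∀ y : S, m.succ.removeNth (k.succ.castSucc.removeNth (Fin.cons y b : Fin (r' + 1 + 2) → S))
          = (Fin.cons y (m.removeNth (k.castSucc.removeNth b)) : Fin (r' + 1) → S) := by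
        intro y
        funext i
        refine Fin.cases ?_ (fun i => ?_) i
        · simp [Fin.removeNth_apply]
        · simp [Fin.removeNth_apply]
      rw [d1, d1, ← Fin.succ_castSucc]
      simp only [Fin.cons_succ]
      have := congrArg (fun F => F (m.removeNth (k.castSucc.removeNth b)))
        (((η.curryLeft (E.bracket (b k.castSucc) (b m.succ))).curryLeft).map_smul f x)
      have h2 : η (Matrix.vecCons (E.bracket (b k.castSucc) (b m.succ))
          (Fin.cons (f • x) (m.removeNth (k.castSucc.removeNth b)))) =
          f * η (Matrix.vecCons (E.bracket (b k.castSucc) (b m.succ))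
          (Fin.cons x (m.removeNth (k.castSucc.removeNth b)))) := this
      rw [h2]; ring
    rw [t1]
    have t2 : ∑ k : Fin (r + 1), (-1 : C) ^ ((k.succ : Fin (r + 2)) : ℕ) *
          E.anchor ((Fin.cons (f • x) b : Fin (r + 2) → S) k.succ)
            (η (k.succ.removeNth (Fin.cons (f • x) b : Fin (r + 2) → S))) =
        f * (∑ k : Fin (r + 1), (-1 : C) ^ ((k.succ : Fin (r + 2)) : ℕ) *
          E.anchor ((Fin.cons x b : Fin (r + 2) → S) k.succ)
            (η (k.succ.removeNth (Fin.cons x b : Fin (r + 2) → S)))) +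
        ∑ k : Fin (r + 1), (-1 : C) ^ ((k : ℕ) + 1) * (E.anchor (b k) f *
          η (Fin.cons x (k.removeNth b))) := by
      rw [Finset.mul_sum, ← Finset.sum_add_distrib]
      refine Finset.sum_congr rfl fun k _ => ?_
      rw [c1, c1, hs]
      simp only [Fin.cons_succ, Derivation.leibniz, smul_eq_mul, Fin.val_succ]
      ring
    have t3 : ∑ l ≥ (0 : Fin (r + 1)), (-1 : C) ^ (((0 : Fin (r + 1)) : ℕ) + (l + 1)) *
        η (Matrix.vecCons (E.bracket ((Fin.cons (f • x) b : Fin (r + 2) → S) (Fin.castSucc 0))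
            ((Fin.cons (f • x) b : Fin (r + 2) → S) l.succ))
          (l.removeNth ((Fin.castSucc 0).removeNth (Fin.cons (f • x) b : Fin (r + 2) → S)))) =
      f * (∑ l ≥ (0 : Fin (r + 1)), (-1 : C) ^ (((0 : Fin (r + 1)) : ℕ) + (l + 1)) *
        η (Matrix.vecCons (E.bracket ((Fin.cons x b : Fin (r + 2) → S) (Fin.castSucc 0))
            ((Fin.cons x b : Fin (r + 2) → S) l.succ))
          (l.removeNth ((Fin.castSucc 0).removeNth (Fin.cons x b : Fin (r + 2) → S))))) -
        ∑ k : Fin (r + 1), (-1 : C) ^ ((k : ℕ) + 1) * (E.anchor (b k) f *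
          η (Fin.cons x (k.removeNth b))) := by
      have : Finset.Ici (0 : Fin (r + 1)) = Finset.univ := by ext; simp
      rw [this, Finset.mul_sum, ← Finset.sum_sub_distrib]
      refine Finset.sum_congr rfl fun l _ => ?_
      rw [Fin.castSucc_zero, c0, c0]
      simp only [Fin.cons_succ, Fin.cons_zero]
      rw [E.bracket_smul_left]
      have := congrArg (fun F => F (l.removeNth b))
        ((η.curryLeft).map_sub (f • E.bracket x (b l)) (E.anchor (b l) f • x))
      have h2 : η (Matrix.vecCons (f • E.bracket x (b l) - E.anchor (b l) f • x) (l.removeNth b)) =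
          f * η (Matrix.vecCons (E.bracket x (b l)) (l.removeNth b)) -
          E.anchor (b l) f * η (Fin.cons x (l.removeNth b)) := by
        rw [map_smul, map_smul] at this
        exact this
      rw [h2]
      simp only [Fin.val_zero, zero_add]
      ring
    rw [t2, t3]
    simp only [Fin.val_zero, pow_zero, one_mul, Fin.cons_zero, c0, map_smul, Derivation.smul_apply,
      smul_eq_mul]
    ring

/-- The Lie algebroid differential `d_A` on forms. -/
def d {q : ℕ} (η : Form C S q) : Form C S (q + 1) where
  toFun := E.koszul η
  map_update_add' := by
    intro _ a i x y
    obtain ⟨K, hK⟩ := E.exists_intAlt η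
    have h2 : IsUnit (2 : C) := by
      have := (IsUnit.mk0 (2 : ℝ) two_ne_zero).map (algebraMap ℝ C)
      rwa [map_ofNat] at this
    refine h2.mul_left_cancel ?_
    rw [mul_add, ← hK, ← hK, ← hK]
    have := K.map_update_add a i x y
    convert this
  map_update_smul' := by
    intro inst a i f x
    obtain rfl : inst = instDecidableEqFin _ := Subsingleton.elim _ _
    obtain ⟨K, hK⟩ := E.exists_intAlt η
    have h2 : IsUnit (2 : C) := by
      have := (IsUnit.mk0 (2 : ℝ) two_ne_zero).map (algebraMap ℝ C)
      rwa [map_ofNat] at this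
    have h0 : ∀ (c : Fin (q + 1) → S) (y : S),
        E.koszul η (Function.update c 0 (f • y)) = f * E.koszul η (Function.update c 0 y) := by
      intro c y
      have e : ∀ z : S, Function.update c 0 z = Fin.cons z (Fin.tail c) := by
        intro z
        conv_lhs => rw [← Fin.cons_self_tail c]
        rw [Fin.update_cons_zero]
      rw [e, e, koszul_smul_zero]
    by_cases hi : i = 0
    · subst hi; exact h0 a x
    · have hsw : ∀ c : Fin (q + 1) → S,
          E.koszul η c = - E.koszul η (c ∘ Equiv.swap 0 i) := by
        intro c
        refine h2.mul_left_cancel ?_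
        rw [mul_neg, ← hK, ← hK, K.map_swap c (Ne.symm hi), neg_neg]
      have hu : ∀ z : S, (Function.update a i z) ∘ Equiv.swap 0 i =
          Function.update (a ∘ Equiv.swap 0 i) 0 z := by
        intro z
        rw [Function.update_comp_equiv]
        simp
      rw [hsw, hsw (Function.update a i x), hu, hu, h0, smul_eq_mul, mul_neg]
  map_eq_zero_of_eq' := by
    intro a i j h hij
    obtain ⟨K, hK⟩ := E.exists_intAlt η
    have h2 : IsUnit (2 : C) := by
      have := (IsUnit.mk0 (2 : ℝ) two_ne_zero).map (algebraMap ℝ C)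
      rwa [map_ofNat] at this
    refine h2.mul_left_cancel ?_
    rw [mul_zero, ← hK]
    exact K.map_eq_zero_of_eq a h hij
end
end LieAlgebroid

section Multilinear
variable {C S N : Type*} [CommRing C] [AddCommGroup S] [Module C S] [AddCommGroup N] [Module C N]

/-- The linear map on bivectors with `x ∧ y ↦ B x y`, for an alternating bilinear map `B`. -/
noncomputable def bivectorLift (B : S →ₗ[C] S →ₗ[C] N) (hB : ∀ x, B x x = 0) : ⋀[C]^2 S →ₗ[C] N :=
  exteriorPower.alternatingMapLinearEquiv
    { toFun := fun v => B (v 0) (v 1)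
      map_update_add' := by
        intro inst v i x y
        obtain rfl : inst = instDecidableEqFin _ := Subsingleton.elim _ _
        fin_cases i <;> simp
      map_update_smul' := by
        intro inst v i f x
        obtain rfl : inst = instDecidableEqFin _ := Subsingleton.elim _ _
        fin_cases i <;> simp
      map_eq_zero_of_eq' := by
        intro v i j h hij
        have h01 : v 0 = v 1 := by
          fin_cases i <;> fin_cases j <;> simp_all
        simp [h01, hB] }

lemma bivectorLift_apply (B : S →ₗ[C] S →ₗ[C] N) (hB : ∀ x, B x x = 0) (x y : S) :
    bivectorLift B hB (exteriorPower.ιMulti C 2 ![x, y]) = B x y := by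
  rw [bivectorLift, exteriorPower.alternatingMapLinearEquiv_apply_ιMulti]; rfl

lemma bivector_ext {f g : ⋀[C]^2 S →ₗ[C] N}
    (h : ∀ x y, f (exteriorPower.ιMulti C 2 ![x, y]) = g (exteriorPower.ιMulti C 2 ![x, y])) :
    f = g := by
  apply exteriorPower.linearMap_ext
  ext v
  have : v = ![v 0, v 1] := by ext i; fin_cases i <;> rfl
  rw [this]; exact h _ _

lemma update_pair_zero {T : Type*} (x y z : T) : Function.update ![x, y] 0 z = ![z, y] := by
  ext i; fin_cases i <;> simp

lemma update_pair_one {T : Type*} (x y z : T) : Function.update ![x, y] 1 z = ![x, z] := by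
  ext i; fin_cases i <;> simp

/-- The bivector `x ∧ y`. -/
noncomputable def wedgeVec : S →ₗ[C] S →ₗ[C] ⋀[C]^2 S :=
  LinearMap.mk₂ C (fun x y => exteriorPower.ιMulti C 2 ![x, y])
    (by
      intro x x' y
      have := (exteriorPower.ιMulti C 2 (M := S)).map_update_add ![x, y] 0 x x'
      rw [update_pair_zero, update_pair_zero, update_pair_zero] at this; exact this)
    (by
      intro c x y
      have := (exteriorPower.ιMulti C 2 (M := S)).map_update_smul ![x, y] 0 c x
      rw [update_pair_zero, update_pair_zero] at this; exact this)
    (by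
      intro x y y'
      have := (exteriorPower.ιMulti C 2 (M := S)).map_update_add ![x, y] 1 y y'
      rw [update_pair_one, update_pair_one, update_pair_one] at this; exact this)
    (by
      intro c x y
      have := (exteriorPower.ιMulti C 2 (M := S)).map_update_smul ![x, y] 1 c y
      rw [update_pair_one, update_pair_one] at this; exact this)

lemma wedgeVec_apply (x y : S) : wedgeVec x y = exteriorPower.ιMulti C 2 ![x, y] := rfl

lemma wedgeVec_self (x : S) : wedgeVec (C := C) x x = 0 :=
  (exteriorPower.ιMulti C 2 (M := S)).map_eq_zero_of_eq ![x, x] (i := 0) (j := 1) rfl (by simp)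

lemma wedgeVec_swap (x y : S) : wedgeVec (C := C) x y = - wedgeVec y x := by
  have h := wedgeVec_self (C := C) (x + y)
  simp only [map_add, LinearMap.add_apply, wedgeVec_self, zero_add, add_zero] at h
  rw [eq_neg_iff_add_eq_zero, add_comm]; exact h

lemma bivector_induction {p : ⋀[C]^2 S → Prop} (h0 : p 0)
    (hw : ∀ x y, p (wedgeVec x y)) (ha : ∀ P Q, p P → p Q → p (P + Q)) (P : ⋀[C]^2 S) : p P := by
  have hP : P ∈ Submodule.span C (Set.range (exteriorPower.ιMulti C 2 (M := S))) := by
    rw [exteriorPower.ιMulti_span]; trivial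
  have key : ∀ c : C, p (c • P) := by
    induction hP using Submodule.span_induction with
    | mem P hP =>
      obtain ⟨v, rfl⟩ := hP
      intro c
      have : v = ![v 0, v 1] := by ext i; fin_cases i <;> rfl
      rw [this, ← wedgeVec_apply, ← LinearMap.smul_apply, ← map_smul]
      exact hw _ _
    | zero => intro c; rw [smul_zero]; exact h0
    | add P Q _ _ hP hQ => intro c; rw [smul_add]; exact ha _ _ (hP c) (hQ c)
    | smul c P hP ih => intro c'; rw [smul_smul]; exact ih _
  simpa using key 1

lemma coe_wedgeVec (x y : S) : ((wedgeVec x y : ⋀[C]^2 S) : ExteriorAlgebra C S) =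
    ExteriorAlgebra.ι C x * ExteriorAlgebra.ι C y := by
  rw [wedgeVec_apply, exteriorPower.ιMulti_apply_coe, ExteriorAlgebra.ιMulti_apply]
  simp

lemma ι_mul_swap (x y : S) : ExteriorAlgebra.ι C x * ExteriorAlgebra.ι C y =
    - (ExteriorAlgebra.ι C y * ExteriorAlgebra.ι C x) := by
  rw [← coe_wedgeVec, wedgeVec_swap]; rw [← coe_wedgeVec]; rfl

/-- Interior product `i_x` of forms by a section `x` of `A`. -/
noncomputable def interiorVec (x : S) {q : ℕ} : Form C S (q + 1) →ₗ[C] Form C S q :=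
  LinearMap.applyₗ x ∘ₗ AlternatingMap.curryLeftLinearMap

lemma interior_apply (x : S) {q : ℕ} (η : Form C S (q + 1)) (v : Fin q → S) :
    interiorVec x η v = η (Matrix.vecCons x v) := rfl

/-- Interior product of forms by a bivector, with `i_{x ∧ y} = i_x ∘ i_y`; thus
`i_{x ∧ y} η = η(y, x, …)`. -/
noncomputable def interiorBi {q : ℕ} : ⋀[C]^2 S →ₗ[C] Form C S (q + 2) →ₗ[C] Form C S q :=
  bivectorLift
    (LinearMap.mk₂ C (fun x y => interiorVec (C := C) x ∘ₗ interiorVec y)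
      (by intros; ext; simp [interiorVec]) (by intros; ext; simp [interiorVec])
      (by intros; ext; simp [interiorVec]) (by intros; ext; simp [interiorVec]))
    (by
      intro x; ext η v
      exact η.map_eq_zero_of_eq (Matrix.vecCons x (Matrix.vecCons x v)) (i := 0) (j := 1) rfl
        (by simp))

/-- `π^♯ : A^* → A`, with `⟨β, π^♯ α⟩ = π(α, β)`; for `π = x ∧ y` it is
`π^♯ α = α(x) y - α(y) x`. -/
noncomputable def sharp : ⋀[C]^2 S →ₗ[C] Module.Dual C S →ₗ[C] S :=
  bivectorLift
    (LinearMap.mk₂ C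
      (fun x y => (Module.Dual.eval C S x).smulRight y - (Module.Dual.eval C S y).smulRight x)
      (by intros; ext; simp [add_smul]; abel)
      (by intros; ext; simp [smul_sub, mul_smul]; rw [smul_comm])
      (by intros; ext; simp [add_smul]; abel)
      (by intros; ext; simp [smul_sub, mul_smul]; rw [smul_comm]))
    (by intro x; ext; simp)

lemma sharp_wedge (x y : S) (α : Module.Dual C S) :
    sharp (wedgeVec x y) α = α x • y - α y • x := by
  rw [wedgeVec_apply, sharp, bivectorLift_apply]; rfl

/-- The exterior product `α ∧ η` of a `1`-form and a `q`-form. -/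
noncomputable def wedge {q : ℕ} (α : Module.Dual C S) (η : Form C S q) : Form C S (q + 1) :=
  AlternatingMap.alternatizeUncurryFin (α.smulRight η)

/-- The two descriptions of sections of `A^*`. -/
def oneForm : Module.Dual C S ≃ₗ[C] Form C S 1 :=
  { AlternatingMap.ofSubsingleton C S C (0 : Fin 1) with
    map_add' := fun _ _ => rfl
    map_smul' := fun _ _ => rfl }

lemma oneForm_apply (α : Module.Dual C S) (v : Fin 1 → S) : oneForm α v = α (v 0) := rfl

lemma oneForm_symm_apply (η : Form C S 1) (x : S) : oneForm.symm η x = η ![x] := by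
  have h := oneForm_apply (oneForm.symm η) ![x]
  rw [LinearEquiv.apply_symm_apply] at h
  exact h.symm

/-- `η ↦ (x ↦ i_x η)` for `2`-forms `η`. -/
noncomputable def flat : Form C S 2 →ₗ[C] S →ₗ[C] Module.Dual C S where
  toFun η := oneForm.symm.toLinearMap ∘ₗ η.curryLeft
  map_add' _ _ := by ext; simp
  map_smul' _ _ := by ext; simp

lemma flat_apply (η : Form C S 2) (x y : S) : flat η x y = η ![x, y] := by
  change oneForm.symm (η.curryLeft x) y = _
  rw [oneForm_symm_apply]; rfl

lemma bivectorDer_alt (J : S →ₗ[C] S) (x : S) :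
    ((wedgeVec ∘ₗ J) + (wedgeVec.flip ∘ₗ J).flip : S →ₗ[C] S →ₗ[C] ⋀[C]^2 S) x x = 0 := by
  simp; rw [wedgeVec_swap, neg_add_cancel]

/-- The action `x ∧ y ↦ J x ∧ y + x ∧ J y` of an endomorphism `J` on bivectors. -/
noncomputable def bivectorDer : (S →ₗ[C] S) →ₗ[C] ⋀[C]^2 S →ₗ[C] ⋀[C]^2 S where
  toFun J := bivectorLift ((wedgeVec ∘ₗ J) + (wedgeVec.flip ∘ₗ J).flip)
    (bivectorDer_alt J)
  map_add' J J' := by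
    apply bivector_ext
    intro x y
    simp only [LinearMap.add_apply, bivectorLift_apply]
    simp; abel
  map_smul' c J := by
    apply bivector_ext
    intro x y
    simp only [LinearMap.smul_apply, bivectorLift_apply, RingHom.id_apply]
    simp

lemma bivectorDer_wedge (J : S →ₗ[C] S) (x y : S) :
    bivectorDer J (wedgeVec x y) = wedgeVec (J x) y + wedgeVec x (J y) := by
  exact bivectorLift_apply _ (bivectorDer_alt J) x y


/-- The form given by an element of the exterior power of the dual, `α₁ ∧ … ∧ α_q` being sent to
`(x₁, …, x_q) ↦ det (α_j (x_i))`. -/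
noncomputable def evalForm {q : ℕ} : ⋀[C]^q (Module.Dual C S) →ₗ[C] Form C S q where
  toFun P := (exteriorPower.pairingDual C S q P).compAlternatingMap (exteriorPower.ιMulti C q)
  map_add' := by intros; ext; simp
  map_smul' := by intros; ext; simp

lemma interior_wedge (α : Module.Dual C S) {q : ℕ} (η : Form C S (q + 1)) (x : S) :
    interiorVec x (wedge α η) = α x • η - wedge α (interiorVec x η) := by
  ext v
  rw [interior_apply, wedge, AlternatingMap.alternatizeUncurryFin_apply, Fin.sum_univ_succ]
  rw [AlternatingMap.sub_apply, wedge, AlternatingMap.alternatizeUncurryFin_apply, sub_eq_add_neg,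
    ← Finset.sum_neg_distrib]
  congr 1
  · simp
  · refine Finset.sum_congr rfl fun i _ => ?_
    have e : i.succ.removeNth (Matrix.vecCons x v) = (Matrix.vecCons x (i.removeNth v) : Fin (q+1) → S) := by
      funext j
      refine Fin.cases ?_ (fun j => ?_) j
      · simp [Fin.removeNth_apply, Matrix.vecCons]
      · simp [Fin.removeNth_apply, Matrix.vecCons]
    rw [e]
    simp [pow_succ, interior_apply]

lemma interior_wedge_zero (α : Module.Dual C S) (η : Form C S 0) (x : S) :
    interiorVec x (wedge α η) = α x • η := by
  ext v
  rw [interior_apply, wedge, AlternatingMap.alternatizeUncurryFin_apply, Fin.sum_univ_one]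
  have e : (0 : Fin 1).removeNth (Matrix.vecCons x v) = v := Subsingleton.elim _ _
  rw [e]; simp

end Multilinear

section Twist
variable {C N₁ N₂ : Type*} [CommRing C] [AddCommGroup N₁] [Module C N₁] [AddCommGroup N₂]
  [Module C N₂]

/-- The additive group `N₁ × N₂` with the `C`-module structure
`f • (n₁, n₂) = (f n₁, f n₂ + δ(f) n₁)`. It serves to define operators which are not `C`-linear
on exterior powers over `C`. -/
structure TwistedProd (δ : Derivation ℤ C (N₁ →ₗ[C] N₂)) where
  fst : N₁
  snd : N₂

namespace TwistedProd
variable {δ : Derivation ℤ C (N₁ →ₗ[C] N₂)}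

@[ext] lemma ext' {a b : TwistedProd δ} (h₁ : a.fst = b.fst) (h₂ : a.snd = b.snd) : a = b := by
  cases a; cases b; simp_all

/-- The underlying pair. -/
def equivProd : TwistedProd δ ≃ N₁ × N₂ := ⟨fun a => (a.fst, a.snd), fun a => ⟨a.1, a.2⟩, fun _ => rfl, fun _ => rfl⟩

instance : AddCommGroup (TwistedProd δ) := equivProd.addCommGroup

instance : SMul C (TwistedProd δ) := ⟨fun f a => ⟨f • a.fst, f • a.snd + δ f a.fst⟩⟩

@[simp] lemma fst_add (a b : TwistedProd δ) : (a + b).fst = a.fst + b.fst := rfl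
@[simp] lemma snd_add (a b : TwistedProd δ) : (a + b).snd = a.snd + b.snd := rfl
@[simp] lemma fst_zero : (0 : TwistedProd δ).fst = 0 := rfl
@[simp] lemma snd_zero : (0 : TwistedProd δ).snd = 0 := rfl
@[simp] lemma fst_smul (f : C) (a : TwistedProd δ) : (f • a).fst = f • a.fst := rfl
@[simp] lemma snd_smul (f : C) (a : TwistedProd δ) : (f • a).snd = f • a.snd + δ f a.fst := rfl

instance : Module C (TwistedProd δ) where
  one_smul a := by ext <;> simp
  mul_smul f g a := by
    ext
    · simp [mul_smul]
    · simp [mul_smul, smul_add]; abel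
  smul_zero f := by ext <;> simp
  smul_add f a b := by
    ext
    · simp
    · simp; abel
  add_smul f g a := by
    ext
    · simp [add_smul]
    · simp [add_smul]; abel
  zero_smul a := by ext <;> simp

/-- The second component, an additive map. -/
def sndHom : TwistedProd δ →+ N₂ := ⟨⟨fun a => a.snd, rfl⟩, fun _ _ => rfl⟩

/-- The first component, a `C`-linear map. -/
def fstHom : TwistedProd δ →ₗ[C] N₁ := ⟨⟨fun a => a.fst, fun _ _ => rfl⟩, fun _ _ => rfl⟩
end TwistedProd
end Twist

namespace LieAlgebroid
section
variable {C S : Type*} [CommRing C] [Algebra ℝ C] [AddCommGroup S] [Module C S]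
  (E : LieAlgebroid C S)

/-- The derivation `f ↦ (n ↦ (ρ(a) f) n)`. -/
def anchorScalar (N : Type*) [AddCommGroup N] [Module C N] (a : S) :
    Derivation ℤ C (N →ₗ[C] N) where
  toFun f := E.anchor a f • LinearMap.id
  map_add' := by intros; simp [add_smul]
  map_smul' := by
    intro m f
    ext n
    change (E.anchor a (m • f)) • n = m • (E.anchor a f • n)
    rw [map_zsmul, smul_assoc]
  map_one_eq_zero' := by simp
  leibniz' f g := by
    ext n
    simp [add_smul, mul_smul]

/-- The 1-form `d_A f` as a linear functional -/
def dFun (f : C) : Module.Dual C S where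
  toFun a := E.anchor a f
  map_add' := by intros; simp
  map_smul' := by intros; simp

@[simp] lemma dFun_apply (f : C) (a : S) : E.dFun f a = E.anchor a f := rfl

lemma dFun_add (f g : C) : E.dFun (f + g) = E.dFun f + E.dFun g := by ext; simp

lemma dFun_mul (f g : C) : E.dFun (f * g) = f • E.dFun g + g • E.dFun f := by ext; simp

lemma anchorScalar_apply (N : Type*) [AddCommGroup N] [Module C N] (a : S) (f : C) (n : N) :
    E.anchorScalar N a f n = E.anchor a f • n := rfl

/-- Auxiliary lift used to define `[a, P]` for a section `a` and a bivector `P`. -/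
noncomputable def lieBivectorAux (a : S) : ⋀[C]^2 S →ₗ[C] TwistedProd (E.anchorScalar (⋀[C]^2 S) a) :=
  bivectorLift
    (LinearMap.mk₂ C
      (fun x y => ⟨wedgeVec x y, wedgeVec (E.bracket a x) y + wedgeVec x (E.bracket a y)⟩)
      (by intros; ext : 1 <;> simp; abel)
      (by
        intro f x y
        ext : 1
        · simp
        · rw [TwistedProd.snd_smul, anchorScalar_apply]
          simp [E.leibniz]; abel)
      (by intros; ext : 1 <;> simp; abel)
      (by
        intro f x y
        ext : 1
        · simp
        · rw [TwistedProd.snd_smul, anchorScalar_apply]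
          simp [E.leibniz]; abel))
    (by
      intro x
      ext : 1
      · simp [wedgeVec_self]
      · simp [wedgeVec_swap x (E.bracket a x)])

/-- The Gerstenhaber bracket `[a, P]` of a section `a` and a bivector `P`:
`[a, x ∧ y] = [a, x] ∧ y + x ∧ [a, y]`. -/
noncomputable def lieBivector (a : S) : ⋀[C]^2 S →+ ⋀[C]^2 S :=
  TwistedProd.sndHom.comp (E.lieBivectorAux a).toAddMonoidHom

lemma lieBivector_wedge (a x y : S) :
    E.lieBivector a (wedgeVec x y) =
      wedgeVec (E.bracket a x) y + wedgeVec x (E.bracket a y) := by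
  change (E.lieBivectorAux a (wedgeVec x y)).snd = _
  rw [wedgeVec_apply, lieBivectorAux, bivectorLift_apply]; rfl

lemma lieBivector_smul (a : S) (f : C) (P : ⋀[C]^2 S) :
    E.lieBivector a (f • P) = f • E.lieBivector a P + E.anchor a f • P := by
  have h : TwistedProd.fstHom ∘ₗ E.lieBivectorAux a = LinearMap.id := by
    apply bivector_ext
    intro x y
    simp only [LinearMap.comp_apply]
    rw [lieBivectorAux, bivectorLift_apply]; rfl
  have h2 : (E.lieBivectorAux a P).fst = P := congrArg (fun F => F P) h
  change (E.lieBivectorAux a (f • P)).snd = _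
  rw [map_smul, TwistedProd.snd_smul, h2]; rfl

lemma lieBivector_smul_left (f : C) (a : S) (Q : ⋀[C]^2 S) :
    E.lieBivector (f • a) Q = f • E.lieBivector a Q - wedgeVec a (sharp Q (E.dFun f)) := by
  induction Q using bivector_induction with
  | h0 => simp
  | hw x y =>
    rw [lieBivector_wedge, lieBivector_wedge, E.bracket_smul_left, E.bracket_smul_left,
      sharp_wedge]
    simp only [map_sub, map_smul, LinearMap.sub_apply, LinearMap.smul_apply, smul_add,
      dFun_apply]
    rw [wedgeVec_swap x a]
    simp only [smul_neg]; abel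
  | ha P Q hP hQ => simp only [map_add, hP, hQ, LinearMap.add_apply, smul_add]; abel

/-- The exterior product `P ∧ v` of a bivector and a section. -/
noncomputable def wedgeBiVec : S →ₗ[C] ⋀[C]^2 S →ₗ[C] ExteriorAlgebra C S :=
  LinearMap.mk₂ C (fun v P => (P : ExteriorAlgebra C S) * ExteriorAlgebra.ι C v)
    (by intros; simp [mul_add]) (by intros; simp) (by intros; simp [add_mul]) (by intros; simp)

/-- The derivation `f ↦ (P ↦ - P ∧ Q^♯(d_A f))`. -/
noncomputable def schoutenTwist (Q : ⋀[C]^2 S) :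
    Derivation ℤ C (⋀[C]^2 S →ₗ[C] ExteriorAlgebra C S) where
  toFun f := - wedgeBiVec (sharp Q (E.dFun f))
  map_add' f g := by rw [dFun_add, map_add, map_add, neg_add]
  map_smul' m f := by
    have h : ∀ f g : C, E.dFun (f + g) = E.dFun f + E.dFun g := E.dFun_add
    have := map_zsmul (AddMonoidHom.mk' E.dFun h) m f
    simp only [AddMonoidHom.mk'_apply] at this
    rw [this, map_zsmul, map_zsmul, ← zsmul_neg]; rfl
  map_one_eq_zero' := by
    have : E.dFun 1 = 0 := by ext; simp
    simp [this]
  leibniz' f g := by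
    simp only [LinearMap.coe_mk, AddHom.coe_mk]
    rw [dFun_mul, map_add, map_add, map_smul, map_smul, map_smul, map_smul, neg_add, smul_neg,
      smul_neg]

lemma schoutenTwist_apply (Q : ⋀[C]^2 S) (f : C) (P : ⋀[C]^2 S) :
    E.schoutenTwist Q f P =
      - ((P : ExteriorAlgebra C S) * ExteriorAlgebra.ι C (sharp Q (E.dFun f))) := rfl

lemma lieBivector_add_left (a b : S) (Q : ⋀[C]^2 S) :
    E.lieBivector (a + b) Q = E.lieBivector a Q + E.lieBivector b Q := by
  induction Q using bivector_induction with
  | h0 => simp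
  | hw x y =>
    simp only [lieBivector_wedge, map_add, LinearMap.add_apply, AddMonoidHom.add_apply]; abel
  | ha P Q hP hQ => simp only [map_add, hP, hQ]; abel

/-- Auxiliary lift used to define the Gerstenhaber bracket of two bivectors. -/
noncomputable def schoutenAux (Q : ⋀[C]^2 S) : ⋀[C]^2 S →ₗ[C] TwistedProd (E.schoutenTwist Q) :=
  bivectorLift
    (LinearMap.mk₂ C
      (fun x y => ⟨wedgeVec x y, ExteriorAlgebra.ι C x * E.lieBivector y Q -
        ExteriorAlgebra.ι C y * E.lieBivector x Q⟩)
      (by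
        intros; ext : 1
        · simp
        · simp [lieBivector_add_left, add_mul, mul_add]; abel)
      (by
        intro f x y; ext : 1
        · simp
        · rw [TwistedProd.snd_smul, schoutenTwist_apply, coe_wedgeVec, lieBivector_smul_left]
          simp only [Submodule.coe_sub, Submodule.coe_smul, coe_wedgeVec, mul_sub, smul_sub,
            map_smul, smul_mul_assoc, mul_smul_comm]
          rw [← mul_assoc, ι_mul_swap y x, neg_mul]; abel)
      (by
        intros; ext : 1
        · simp
        · simp [lieBivector_add_left, add_mul, mul_add]; abel)
      (by
        intro f x y; ext : 1
        · simp
        · rw [TwistedProd.snd_smul, schoutenTwist_apply, coe_wedgeVec, lieBivector_smul_left]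
          simp only [Submodule.coe_sub, Submodule.coe_smul, coe_wedgeVec, mul_sub, smul_sub,
            map_smul, smul_mul_assoc, mul_smul_comm]
          rw [← mul_assoc]; abel))
    (by
      intro x
      ext : 1
      · simp [wedgeVec_self]
      · simp)

/-- The Gerstenhaber bracket `[P, Q]` of two bivectors, a `3`-vector. It is biadditive and given on
decomposable bivectors by the usual formula, see `schouten_wedge_wedge`. -/
noncomputable def schouten (P Q : ⋀[C]^2 S) : ExteriorAlgebra C S := (E.schoutenAux Q P).snd

lemma schouten_add_left (P P' Q : ⋀[C]^2 S) :
    E.schouten (P + P') Q = E.schouten P Q + E.schouten P' Q := by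
  rw [schouten, map_add]; rfl

lemma schouten_wedge_left (x y : S) (Q : ⋀[C]^2 S) :
    E.schouten (wedgeVec x y) Q = ExteriorAlgebra.ι C x * E.lieBivector y Q -
        ExteriorAlgebra.ι C y * E.lieBivector x Q := by
  rw [schouten, wedgeVec_apply, schoutenAux, bivectorLift_apply]; rfl

lemma schouten_add_right (P Q Q' : ⋀[C]^2 S) :
    E.schouten P (Q + Q') = E.schouten P Q + E.schouten P Q' := by
  induction P using bivector_induction with
  | h0 => simp [schouten]
  | hw x y => simp only [schouten_wedge_left, map_add, Submodule.coe_add, mul_add]; abel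
  | ha P Q hP hQ => rw [schouten_add_left, hP, hQ, schouten_add_left, schouten_add_left]; abel

/-- The value of the Gerstenhaber bracket on decomposable bivectors:
`[a₁ ∧ a₂, b₁ ∧ b₂] = ∑ (-1)^{k + l} [a_k, b_l] ∧ a_{k̂} ∧ b_{l̂}`. -/
lemma schouten_wedge_wedge (a₁ a₂ b₁ b₂ : S) :
    E.schouten (wedgeVec a₁ a₂) (wedgeVec b₁ b₂) =
      ExteriorAlgebra.ιMulti C 3 ![E.bracket a₁ b₁, a₂, b₂]
      - ExteriorAlgebra.ιMulti C 3 ![E.bracket a₁ b₂, a₂, b₁]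
      - ExteriorAlgebra.ιMulti C 3 ![E.bracket a₂ b₁, a₁, b₂]
      + ExteriorAlgebra.ιMulti C 3 ![E.bracket a₂ b₂, a₁, b₁] := by
  rw [schouten_wedge_left, lieBivector_wedge, lieBivector_wedge]
  simp only [ExteriorAlgebra.ιMulti_apply, Submodule.coe_add, coe_wedgeVec, mul_add]
  simp [← mul_assoc]
  have rot : ∀ x y z : S, ExteriorAlgebra.ι C x * ExteriorAlgebra.ι C y * ExteriorAlgebra.ι C z =
      ExteriorAlgebra.ι C z * ExteriorAlgebra.ι C x * ExteriorAlgebra.ι C y := by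
    intro x y z
    rw [mul_assoc, ι_mul_swap y z, mul_neg, ← mul_assoc, ι_mul_swap x z, neg_mul, neg_neg]
  rw [rot a₁ b₁, rot a₂ b₁, ι_mul_swap a₁ (E.bracket a₂ b₁), ι_mul_swap a₂ (E.bracket a₁ b₁),
    neg_mul, neg_mul]
  abel


lemma d_add {q : ℕ} (η ζ : Form C S q) : E.d (η + ζ) = E.d η + E.d ζ := by
  ext a
  change E.koszul (η + ζ) a = E.koszul η a + E.koszul ζ a
  cases q with
  | zero => simp [koszul]
  | succ q =>
    simp only [koszul, AlternatingMap.add_apply, map_add, mul_add, Finset.sum_add_distrib]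
    abel

lemma d_smul {q : ℕ} (f : C) (η : Form C S q) :
    E.d (f • η) = f • E.d η + wedge (E.dFun f) η := by
  ext a
  rw [AlternatingMap.add_apply, AlternatingMap.smul_apply, wedge,
    AlternatingMap.alternatizeUncurryFin_apply]
  change E.koszul (f • η) a = f * E.koszul η a + _
  cases q with
  | zero =>
    have e : (0 : Fin 1).removeNth a = ![] := Subsingleton.elim _ _
    rw [Fin.sum_univ_one, e]
    simp [koszul, mul_comm]
  | succ q =>
    simp only [koszul, AlternatingMap.smul_apply, smul_eq_mul, Derivation.leibniz, mul_add,
      Finset.sum_add_distrib, Finset.mul_sum, LinearMap.smulRight_apply, dFun_apply]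
    simp only [zsmul_eq_mul, Int.cast_pow, Int.cast_neg, Int.cast_one]
    rw [add_right_comm]
    refine congrArg₂ (· + ·) (congrArg₂ (· + ·) ?_ ?_) ?_
    · exact Finset.sum_congr rfl fun k _ => by ring
    · exact Finset.sum_congr rfl fun k _ => Finset.sum_congr rfl fun l _ => by ring
    · exact Finset.sum_congr rfl fun k _ => by ring

/-- The Lie derivation of forms, `L_x = [i_x, d_A] = i_x d_A + d_A i_x`. -/
noncomputable def lieDer (x : S) : ∀ {q : ℕ}, Form C S q → Form C S q
  | 0, η => interiorVec x (E.d η)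
  | _ + 1, η => interiorVec x (E.d η) + E.d (interiorVec x η)

lemma lieDer_add (x : S) {q : ℕ} (η ζ : Form C S q) :
    E.lieDer x (η + ζ) = E.lieDer x η + E.lieDer x ζ := by
  cases q <;> simp only [lieDer, d_add, map_add]
  abel

lemma lieDer_smul (x : S) {q : ℕ} (f : C) (η : Form C S q) :
    E.lieDer x (f • η) = f • E.lieDer x η + E.anchor x f • η := by
  cases q with
  | zero => simp only [lieDer, d_smul, map_add, map_smul, interior_wedge_zero, dFun_apply]
  | succ q =>
    simp only [lieDer, d_smul, map_add, map_smul, interior_wedge, dFun_apply, smul_add]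
    abel

end
end LieAlgebroid

section Square
variable {C L : Type*} [CommRing C] [Algebra ℝ C] [AddCommGroup L] [Module C L]

/-- If `D` is a first-order operator on `L` over the derivation `X` (e.g. a covariant or Lie
derivative on a line bundle), this is the induced operator `D ⊗ 1 + 1 ⊗ D` on `L ⊗ L`. -/
noncomputable def squareOp (D : L →+ L) (X : Derivation ℝ C C)
    (h : ∀ (f : C) (m : L), D (f • m) = f • D m + X f • m) : L ⊗[C] L →+ L ⊗[C] L :=
  TensorProduct.liftAddHom
    { toFun := fun m =>
        { toFun := fun n => D m ⊗ₜ[C] n + m ⊗ₜ[C] D n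
          map_zero' := by simp
          map_add' := by intros; simp only [map_add, TensorProduct.tmul_add]; abel }
      map_zero' := by ext; simp
      map_add' := by
        intros; ext
        simp only [map_add, TensorProduct.add_tmul, AddMonoidHom.coe_mk, ZeroHom.coe_mk,
          AddMonoidHom.add_apply]
        abel }
    (by
      intro f m n
      simp only [AddMonoidHom.coe_mk, ZeroHom.coe_mk, h, TensorProduct.add_tmul,
        TensorProduct.tmul_add, TensorProduct.tmul_smul, TensorProduct.smul_tmul']
      abel)
end Square

section Ops
variable {C S : Type*} [CommRing C] [Algebra ℝ C] [AddCommGroup S] [Module C S]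


lemma dual_sharp_swap (P : ⋀[C]^2 S) (α β : Module.Dual C S) :
    β (sharp P α) = - α (sharp P β) := by
  induction P using bivector_induction with
  | h0 => simp
  | hw x y => rw [sharp_wedge, sharp_wedge]; simp; ring
  | ha P Q hP hQ => simp only [map_add, LinearMap.add_apply, hP, hQ]; ring

/-- The bivector `(∧²π^♯) η` for a `2`-form `η`: its value on `(α, β)` is `η(π^♯ α, π^♯ β)`, see
`sharp_wedgeTwoSharp`. -/
noncomputable def wedgeTwoSharp (P : ⋀[C]^2 S) : Form C S 2 →ₗ[C] ⋀[C]^2 S :=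
  algebraMap ℝ C (-(1 / 2)) •
    ((bivectorDer (C := C) (S := S)).flip P ∘ₗ (LinearMap.llcomp C S (Module.Dual C S) S (sharp P)) ∘ₗ flat)

lemma wedgeTwoSharp_apply (P : ⋀[C]^2 S) (η : Form C S 2) :
    wedgeTwoSharp P η = algebraMap ℝ C (-(1 / 2)) • bivectorDer (sharp P ∘ₗ flat η) P := rfl

lemma sharp_wedgeTwoSharp (P : ⋀[C]^2 S) (η : Form C S 2) (α β : Module.Dual C S) :
    β (sharp (wedgeTwoSharp P η) α) = η ![sharp P α, sharp P β] := by
  have h1 : ∀ (J : S →ₗ[C] S) (Q : ⋀[C]^2 S), β (sharp (bivectorDer J Q) α) =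
      β (sharp Q (α ∘ₗ J)) + (β ∘ₗ J) (sharp Q α) := by
    intro J Q
    induction Q using bivector_induction with
    | h0 => simp
    | hw x y =>
      rw [bivectorDer_wedge]
      simp only [map_add, LinearMap.add_apply, sharp_wedge]
      simp; ring
    | ha P Q hP hQ => simp only [map_add, LinearMap.add_apply, hP, hQ]; ring
  have h2 : ∀ γ : Module.Dual C S, γ ∘ₗ (sharp P ∘ₗ flat η) = flat η (sharp P γ) := by
    intro γ
    ext z
    simp only [LinearMap.comp_apply]
    rw [dual_sharp_swap, flat_apply, flat_apply]
    have := η.map_swap ![z, sharp P γ] (i := 0) (j := 1) (by simp)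
    rw [← this]; congr 1; ext i; fin_cases i <;> simp
  have h3 : η ![sharp P β, sharp P α] = - η ![sharp P α, sharp P β] := by
    have := η.map_swap ![sharp P α, sharp P β] (i := 0) (j := 1) (by simp)
    rw [← this]; congr 1; ext i; fin_cases i <;> simp
  rw [wedgeTwoSharp_apply, map_smul, LinearMap.smul_apply, map_smul, h1, h2, h2,
    dual_sharp_swap, flat_apply, flat_apply, h3, ← neg_add, ← two_mul, smul_eq_mul]
  have : algebraMap ℝ C (-(1 / 2)) * 2 = -1 := by
    rw [← map_ofNat (algebraMap ℝ C), ← map_mul]; norm_num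
  linear_combination (-(η ![sharp P α, sharp P β])) * this

end Ops

section Twisted
variable {C S : Type*} [CommRing C] [Algebra ℝ C] [AddCommGroup S] [Module C S]

namespace LieAlgebroid
variable (E : LieAlgebroid C S)

/-- The Lie derivation as an additive map. -/
noncomputable def lieDerHom (x : S) (q : ℕ) : Form C S q →+ Form C S q :=
  AddMonoidHom.mk' (E.lieDer x) (E.lieDer_add x)

/-- `(A, π, ψ)` is a Lie algebroid with a twisted Poisson structure: `ψ` is `d_A`-closed and
`(1/2) [π, π] = (∧³π^♯) ψ`. -/
def IsTwistedPoisson (π : ⋀[C]^2 S) (ψ : ⋀[C]^3 (Module.Dual C S)) : Prop :=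
  E.d (evalForm ψ) = 0 ∧
    algebraMap ℝ C (1 / 2) • E.schouten π π =
      (exteriorPower.map 3 (sharp π) ψ : ExteriorAlgebra C S)

/-- The bracket of sections of `A^*`, `[α, β]_{π,ψ} =
L_{π^♯α} β - L_{π^♯β} α - d_A (π(α, β)) + ψ(π^♯α, π^♯β, ·)`. -/
noncomputable def dualBracket (π : ⋀[C]^2 S) (ψ : ⋀[C]^3 (Module.Dual C S))
    (α β : Module.Dual C S) : Module.Dual C S :=
  oneForm.symm (E.lieDer (sharp π α) (oneForm β)) - oneForm.symm (E.lieDer (sharp π β) (oneForm α))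
    - E.dFun (β (sharp π α))
    + oneForm.symm (interiorVec (sharp π β) (interiorVec (sharp π α) (evalForm ψ)))

/-- `∂_π = [d_A, i_π] = d_A i_π - i_π d_A` (with `i_π = 0` on forms of degree `0` and `1`). -/
noncomputable def partialPi (π : ⋀[C]^2 S) : ∀ {q : ℕ}, Form C S q → Form C S (q - 1)
  | 0, _ => 0
  | 1, η => - interiorBi π (E.d η)
  | _ + 2, η => E.d (interiorBi π η) - interiorBi π (E.d η)

end LieAlgebroid

/-- The bivector-valued `1`-form `ψ^{(2)}`, with
`ψ^{(2)}(z)(α, β) = ψ(π^♯α, π^♯β, z)`. -/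
noncomputable def psiTwo (π : ⋀[C]^2 S) (ψ : ⋀[C]^3 (Module.Dual C S)) : S →ₗ[C] ⋀[C]^2 S :=
  wedgeTwoSharp π ∘ₗ (evalForm ψ).curryLeft

lemma sharp_psiTwo (π : ⋀[C]^2 S) (ψ : ⋀[C]^3 (Module.Dual C S)) (z : S) (α β : Module.Dual C S) :
    β (sharp (psiTwo π ψ z) α) = evalForm ψ ![sharp π α, sharp π β, z] := by
  have h : β (sharp (psiTwo π ψ z) α) = evalForm ψ ![z, sharp π α, sharp π β] :=
    sharp_wedgeTwoSharp π _ α β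
  have h1 := (evalForm ψ).map_swap ![z, sharp π α, sharp π β] (i := 0) (j := 1) (by simp)
  have h2 := (evalForm ψ).map_swap ![sharp π α, z, sharp π β] (i := 1) (j := 2) (by simp)
  have e1 : ![z, sharp π α, sharp π β] ∘ Equiv.swap 0 1 = ![sharp π α, z, sharp π β] := by
    ext i; fin_cases i <;> rfl
  have e2 : ![sharp π α, z, sharp π β] ∘ Equiv.swap 1 2 = ![sharp π α, sharp π β, z] := by
    ext i; fin_cases i <;> rfl
  rw [e1] at h1
  rw [e2] at h2
  rw [h, h2, h1, neg_neg]

/-- The operator of degree `-1` on forms given by the interior product by the `1`-form-valued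
bivector `ψ^{(2)}`, where `i_{ξ ⊗ P} η = ξ ∧ i_P η`; it vanishes on forms of degree `0` and `1`. -/
noncomputable def partialUnder (π : ⋀[C]^2 S) (ψ : ⋀[C]^3 (Module.Dual C S)) :
    ∀ {q : ℕ}, Form C S q → Form C S (q - 1)
  | 0, _ => 0
  | 1, _ => 0
  | _ + 2, η => AlternatingMap.alternatizeUncurryFin (interiorBi.flip η ∘ₗ psiTwo π ψ)

/-- The contraction `⟨π, ψ⟩`, the `1`-form `z ↦ ψ(x, y, z)` for `π = x ∧ y`. -/
noncomputable def contractPsi (π : ⋀[C]^2 S) (ψ : ⋀[C]^3 (Module.Dual C S)) : Module.Dual C S :=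
  - oneForm.symm (interiorBi π (evalForm ψ))

/-- The section `Y_{π,ψ} = π^♯ ⟨π, ψ⟩` of `A`. It satisfies
`⟨α, Y⟩ = (1/2) Tr (β ↦ ψ(π^♯α, π^♯β, ·))`. -/
noncomputable def sectionY (π : ⋀[C]^2 S) (ψ : ⋀[C]^3 (Module.Dual C S)) : S :=
  sharp π (contractPsi π ψ)

namespace LieAlgebroid
variable (E : LieAlgebroid C S)

/-- `∂ = ∂_π + ∂̲_{π,ψ} + i_{Y_{π,ψ}}`, an operator of degree `-1` on forms. -/
noncomputable def generator (π : ⋀[C]^2 S) (ψ : ⋀[C]^3 (Module.Dual C S)) :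
    ∀ {q : ℕ}, Form C S q → Form C S (q - 1)
  | 0, _ => 0
  | q + 1, η =>
    show Form C S q from
      (show Form C S q from E.partialPi π η) + (show Form C S q from partialUnder π ψ η) +
        interiorVec (sectionY π ψ) η

/-- `D^∂_α μ = - α ∧ ∂ μ`, for a `1`-form `α` and an `N`-form `μ` (zero when `N = 0`, as `∂` then
vanishes). -/
noncomputable def generatorRep (π : ⋀[C]^2 S) (ψ : ⋀[C]^3 (Module.Dual C S))
    (α : Module.Dual C S) : ∀ {N : ℕ}, Form C S N → Form C S N
  | 0, _ => 0
  | _ + 1, μ => - wedge α (E.generator π ψ μ)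

/-- The function `i_π d_A α`, for a `1`-form `α`. -/
noncomputable def interiorPiD (π : ⋀[C]^2 S) (α : Module.Dual C S) : C :=
  interiorBi π (E.d (oneForm α)) ![]

/-- `Z = Z_{π,ψ,μ} = X_{π,μ} + Y_{π,ψ}` where, for all `1`-forms `α`,
`⟨α, X_{π,μ}⟩ μ = L_{π^♯α} μ - (i_π d_A α) μ`. Here `μ` is a volume form. -/
def IsModularSection {N : ℕ} (π : ⋀[C]^2 S) (ψ : ⋀[C]^3 (Module.Dual C S)) (μ : Form C S N)
    (Z : S) : Prop :=
  ∃ X : S, (∀ α : Module.Dual C S,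
      α X • μ = E.lieDer (sharp π α) μ - E.interiorPiD π α • μ) ∧
    Z = X + sectionY π ψ

/-- The same for a density: a nowhere vanishing density `|μ|` is given by its square
`σ = |μ| ⊗ |μ|`, a section of `∧^N A^* ⊗ ∧^N A^*`, and the equation
`⟨α, X⟩ |μ| = L_{π^♯α} |μ| - (i_π d_A α) |μ|` becomes
`2 ⟨α, X⟩ σ = L_{π^♯α} σ - 2 (i_π d_A α) σ`. -/
def IsModularSectionDensity {N : ℕ} (π : ⋀[C]^2 S) (ψ : ⋀[C]^3 (Module.Dual C S))
    (σ : Form C S N ⊗[C] Form C S N) (Z : S) : Prop :=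
  ∃ X : S, (∀ α : Module.Dual C S,
      (2 * α X) • σ =
        squareOp (E.lieDerHom (sharp π α) N) (E.anchor (sharp π α)) (E.lieDer_smul (sharp π α)) σ
          - (2 * E.interiorPiD π α) • σ) ∧
    Z = X + sectionY π ψ

/-- Closed `1`-forms on the Lie algebroid. -/
def cocycles : Submodule ℝ (Module.Dual C S) where
  carrier := {θ | ∀ x y, E.anchor x (θ y) - E.anchor y (θ x) - θ (E.bracket x y) = 0}
  zero_mem' := by intro x y; simp
  add_mem' := by
    intro θ η hθ hη x y
    simp only [LinearMap.add_apply, map_add]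
    linear_combination hθ x y + hη x y
  smul_mem' := by
    intro r θ hθ x y
    rw [LinearMap.smul_apply, LinearMap.smul_apply, LinearMap.smul_apply, Derivation.map_smul,
      Derivation.map_smul, ← smul_sub, ← smul_sub, hθ x y, smul_zero]

lemma mem_cocycles_iff (θ : Module.Dual C S) : θ ∈ E.cocycles ↔ E.d (oneForm θ) = 0 := by
  have key : ∀ a : Fin 2 → S, E.d (oneForm θ) a =
      E.anchor (a 0) (θ (a 1)) - E.anchor (a 1) (θ (a 0)) - θ (E.bracket (a 0) (a 1)) := by
    intro a
    change E.koszul (oneForm θ) a = _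
    simp [koszul, oneForm_apply, Fin.sum_univ_two, Fin.removeNth_apply]
    ring
  constructor
  · intro h; ext a; rw [key]; exact h _ _
  · intro h x y
    have := key ![x, y]
    rw [h] at this
    simpa using this.symm

/-- Exact `1`-forms `d f` on the Lie algebroid. -/
def coboundaries : Submodule ℝ (Module.Dual C S) where
  carrier := {θ | ∃ f : C, θ = E.dFun f}
  zero_mem' := ⟨0, by ext; simp⟩
  add_mem' := by rintro _ _ ⟨f, rfl⟩ ⟨g, rfl⟩; exact ⟨f + g, (E.dFun_add f g).symm⟩
  smul_mem' := by rintro r _ ⟨f, rfl⟩; exact ⟨r • f, by ext; simp⟩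

noncomputable instance : AddCommGroup (Module.Dual C S) :=
  inferInstanceAs (AddCommGroup (S →ₗ[C] C))

/-- The first cohomology space of the Lie algebroid (with trivial coefficients). -/
abbrev H1 : Type _ := E.cocycles ⧸ E.coboundaries.submoduleOf E.cocycles

/-- The class of a cocycle. -/
noncomputable abbrev classOf (θ : E.cocycles) : E.H1 := Submodule.Quotient.mk θ

end LieAlgebroid

/-- A representation of a Lie algebroid on a vector bundle, with module of sections `L`. -/
structure Representation (E : LieAlgebroid C S) (L : Type*) [AddCommGroup L] [Module C L] where
  /-- the operators `D_x` -/
  D : S →+ L →+ L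
  smul_left : ∀ (f : C) (x : S) (m : L), D (f • x) m = f • D x m
  leibniz : ∀ (x : S) (f : C) (m : L), D x (f • m) = f • D x m + E.anchor x f • m
  flat : ∀ (x y : S) (m : L), D (E.bracket x y) m = D x (D y m) - D y (D x m)

/-- A nowhere vanishing section of a line bundle, with module of sections `L`: a section `s` such
that each section is `f • s` for exactly one function `f`. -/
def IsFrame (C : Type*) {L : Type*} [CommRing C] [AddCommGroup L] [Module C L] (s : L) : Prop :=
  Function.Bijective fun f : C => f • s

/-- `c` is the characteristic class of the Lie algebroid `E` associated to the representation `R`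
on a line bundle `L`. If `s` is a nowhere vanishing section of `L`, then `c = [θ]` where
`D_x s = ⟨θ, x⟩ s`. In general, `c` is one half of the class thus obtained from the square `L ⊗ L`
(which always is a trivial line bundle). -/
def Representation.IsCharacteristicClass {E : LieAlgebroid C S} {L : Type*} [AddCommGroup L]
    [Module C L] (R : Representation E L) (c : E.H1) : Prop :=
  (∀ s : L, IsFrame C s → ∃ θ : E.cocycles,
    (∀ x, R.D x s = (θ : Module.Dual C S) x • s) ∧ c = E.classOf θ) ∧
  (∀ σ : L ⊗[C] L, IsFrame C σ → ∃ θ : E.cocycles,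
    (∀ x, squareOp (R.D x) (E.anchor x) (R.leibniz x) σ = (θ : Module.Dual C S) x • σ) ∧
      c = (1 / 2 : ℝ) • E.classOf θ)

end Twisted

section Geometry
variable {V : Type*} [NormedAddCommGroup V] [NormedSpace ℝ V]
  {H : Type*} [TopologicalSpace H] {I : ModelWithCorners ℝ V H}
  {M : Type*} [TopologicalSpace M] [ChartedSpace H M]
  {F : Type*} [NormedAddCommGroup F] [NormedSpace ℝ F]
  {A : M → Type*} [TopologicalSpace (Bundle.TotalSpace F A)] [∀ x, TopologicalSpace (A x)]
  [∀ x, AddCommGroup (A x)] [∀ x, Module ℝ (A x)] [FiberBundle F A] [VectorBundle ℝ F A]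

noncomputable instance : SMul C^∞⟮I, M; ℝ⟯ Cₛ^∞⟮I; F, A⟯ :=
  ⟨fun f s => ⟨fun x => f x • s x, f.contMDiff.smul_section s.contMDiff⟩⟩

lemma smul_section_apply (f : C^∞⟮I, M; ℝ⟯) (s : Cₛ^∞⟮I; F, A⟯) (x : M) :
    (f • s) x = f x • s x := rfl

/-- The `C^∞(M)`-module of smooth sections of a vector bundle. -/
noncomputable instance : Module C^∞⟮I, M; ℝ⟯ Cₛ^∞⟮I; F, A⟯ where
  one_smul s := by ext x; simp [smul_section_apply]
  mul_smul f g s := by ext x; simp [smul_section_apply, mul_smul]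
  smul_zero f := by ext x; simp [smul_section_apply]
  smul_add f s t := by ext x; simp [smul_section_apply]
  add_smul f g s := by ext x; simp [smul_section_apply, add_smul]
  zero_smul s := by ext x; simp [smul_section_apply]

/-- A volume form on `A`: a nowhere vanishing section of `∧^N A^*` (`N` the rank of `A`). -/
def IsVolumeForm {N : ℕ} (μ : Form C^∞⟮I, M; ℝ⟯ Cₛ^∞⟮I; F, A⟯ N) : Prop :=
  ∀ x : M, ∃ a : Fin N → Cₛ^∞⟮I; F, A⟯, μ a x ≠ 0

/-- `c` is the modular class of `(A, π, ψ)`: the class, in the cohomology of the Lie algebroid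
`A^*` (whose structure is `Edual`), of the section `Z_{π,ψ,μ}` of `A`, for every volume form `μ`,
resp. of the section `Z_{π,ψ,|μ|}`, for every nowhere vanishing density `|μ|`. Sections of `A` are
`1`-forms on `A^*` by evaluation. -/
def IsModularClass (N : ℕ) (E : LieAlgebroid C^∞⟮I, M; ℝ⟯ Cₛ^∞⟮I; F, A⟯)
    (π : ⋀[C^∞⟮I, M; ℝ⟯]^2 Cₛ^∞⟮I; F, A⟯)
    (ψ : ⋀[C^∞⟮I, M; ℝ⟯]^3 (Module.Dual C^∞⟮I, M; ℝ⟯ Cₛ^∞⟮I; F, A⟯))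
    (Edual : LieAlgebroid C^∞⟮I, M; ℝ⟯ (Module.Dual C^∞⟮I, M; ℝ⟯ Cₛ^∞⟮I; F, A⟯))
    (c : Edual.H1) : Prop :=
  (∀ μ : Form C^∞⟮I, M; ℝ⟯ Cₛ^∞⟮I; F, A⟯ N, IsVolumeForm μ →
    ∃ (Z : Cₛ^∞⟮I; F, A⟯)
      (hZ : Module.Dual.eval C^∞⟮I, M; ℝ⟯ Cₛ^∞⟮I; F, A⟯ Z ∈ Edual.cocycles),
      E.IsModularSection π ψ μ Z ∧ c = Edual.classOf ⟨_, hZ⟩) ∧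
  (∀ σ : Form C^∞⟮I, M; ℝ⟯ Cₛ^∞⟮I; F, A⟯ N ⊗[C^∞⟮I, M; ℝ⟯] Form C^∞⟮I, M; ℝ⟯ Cₛ^∞⟮I; F, A⟯ N,
    IsFrame C^∞⟮I, M; ℝ⟯ σ →
    ∃ (Z : Cₛ^∞⟮I; F, A⟯)
      (hZ : Module.Dual.eval C^∞⟮I, M; ℝ⟯ Cₛ^∞⟮I; F, A⟯ Z ∈ Edual.cocycles),
      E.IsModularSectionDensity π ψ σ Z ∧ c = Edual.classOf ⟨_, hZ⟩)

end Geometry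

end TwistedPoisson

open TwistedPoisson

/-! On forms of top degree, `α ∧ i_x μ = ⟨α, x⟩ μ`, because `α ∧ μ` has degree larger than the rank.
Applied to the three summands of `∂`, this gives `L_{π^♯α} μ - (i_π d_A α) μ` from `∂_π`, `2⟨α, Y⟩
μ` from the interior product by `ψ^{(2)}`, and `-⟨α, Y⟩ μ` from `i_Y`. Hence `D^∂_α μ = L_{π^♯α} μ +
m(α) μ` with `m(α) = ⟨α, Y⟩ - i_π d_A α` (`generatorRep_eq`). For a nowhere vanishing `λ` the
right-hand side is `⟨α, X + Y⟩ λ`, so `Z` is itself the cocycle of `D^∂` in the frame `λ`. For a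
density the same computation on the square of the line bundle gives `2Z`.

The structural statements rest on the 2-form `ω_α = d_A α - i_{π^♯α} ψ` (`twistedD`), for which `[α,
β] = L_{π^♯α} β - i_{π^♯β} ω_α` and `m(α) = - i_π ω_α`. The equation for `[π, π]` says that `π^♯`
preserves brackets (`sharp_dualBracket`). Closedness of `ψ` then gives `ω_{[α,β]} = L_{π^♯α} ω_β -
L_{π^♯β} ω_α` (`twistedD_dualBracket`), and the Jacobi identity follows from Cartan calculus.
Flatness of `D^∂` amounts to `m` being a cocycle (`modularFun_dualBracket`): `[π^♯α, π]` acts as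
`(∧²π^♯) ω_α`, whose pairing with `ω_β` is symmetric in `α` and `β`, so it disappears after
antisymmetrization.

Independence of `λ` is the usual change of frame by `f`, which alters the cocycle by `d log |f|`.
Geometry enters only through bump functions: they supply local frames, the identification of the
bidual of `A` with `A`, and that of volume forms with generators of the module of top forms. -/

namespace TwistedPoisson

/-! ### Cartan calculus of a Lie algebroid. -/

section Cartan
variable {C S : Type*} [CommRing C] [AddCommGroup S] [Module C S]

lemma Form.cons_swap {q : ℕ} (η : Form C S (q + 2)) (x y : S) (v : Fin q → S) :
    η (Matrix.vecCons x (Matrix.vecCons y v)) = - η (Matrix.vecCons y (Matrix.vecCons x v)) := by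
  have h := η.map_swap (Matrix.vecCons y (Matrix.vecCons x v)) (i := 0) (j := 1) (by simp)
  rw [← h]
  congr 1
  funext i
  refine Fin.cases ?_ (fun i => Fin.cases ?_ (fun i => ?_) i) i
  · simp
  · simp
  · have h0 : (i.succ.succ : Fin (q + 2)) ≠ 0 := Fin.succ_ne_zero _
    have h1 : (i.succ.succ : Fin (q + 2)) ≠ 1 := by
      intro h; exact Fin.succ_ne_zero i (Fin.succ_injective _ h)
    simp [Equiv.swap_apply_of_ne_of_ne h0 h1]

lemma Form.pair_swap (η : Form C S 2) (x y : S) : η ![x, y] = - η ![y, x] :=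
  Form.cons_swap η x y ![]

lemma Form.ext_interior {q : ℕ} {η ζ : Form C S (q + 1)}
    (h : ∀ x, interiorVec x η = interiorVec x ζ) : η = ζ := by
  ext a
  have := congrArg (fun F => F (Fin.tail a)) (h (a 0))
  simp only [interior_apply] at this
  have e : (Matrix.vecCons (a 0) (Fin.tail a) : Fin (q + 1) → S) = a := Fin.cons_self_tail a
  rwa [e] at this

lemma interiorVec_anticomm (x y : S) {q : ℕ} (η : Form C S (q + 2)) :
    interiorVec x (interiorVec y η) = - interiorVec y (interiorVec x η) := by
  ext v
  exact Form.cons_swap η y x v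

lemma interiorVec_add_left (x y : S) {q : ℕ} (η : Form C S (q + 1)) :
    interiorVec (x + y) η = interiorVec x η + interiorVec y η := by
  ext v
  exact congrArg (fun F => F v) (η.curryLeft.map_add x y)

lemma interiorVec_smul_left (f : C) (x : S) {q : ℕ} (η : Form C S (q + 1)) :
    interiorVec (f • x) η = f • interiorVec x η := by
  ext v
  exact congrArg (fun F => F v) (η.curryLeft.map_smul f x)

lemma interiorVec_zero_left {q : ℕ} (η : Form C S (q + 1)) :
    interiorVec (0 : S) η = 0 := by
  ext v
  exact congrArg (fun F => F v) η.curryLeft.map_zero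

lemma interiorBi_wedge (x y : S) {q : ℕ} (η : Form C S (q + 2)) :
    interiorBi (wedgeVec x y) η = interiorVec x (interiorVec y η) := by
  rw [wedgeVec_apply, interiorBi, bivectorLift_apply]; rfl

end Cartan

namespace LieAlgebroid
variable {C S : Type*} [CommRing C] [Algebra ℝ C] [AddCommGroup S] [Module C S]
  (E : LieAlgebroid C S)

lemma koszul_cons_zero (η : Form C S 1) (x : S) (a : Fin 1 → S) :
    E.koszul η (Matrix.vecCons x a) = E.anchor x (η a) - E.anchor (a 0) (η ![x])
      - η ![E.bracket x (a 0)] := by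
  have e : a = ![a 0] := by ext i; fin_cases i; rfl
  rw [e]
  have e1 : Fin.removeNth 1 ![x, a 0] = ![x] := by ext i; fin_cases i; rfl
  simp [koszul, Fin.sum_univ_two, e1]
  ring

/-- Splitting off the terms of the Koszul sum that involve the first slot: this is `i_x d = L_x - d
i_x`, with `L_x` still written out. Degree one is separate because `koszul` is defined by cases on
the degree of the form. -/
lemma koszul_cons {r : ℕ} (η : Form C S (r + 2)) (x : S) (a : Fin (r + 2) → S) :
    E.koszul η (Matrix.vecCons x a) = E.anchor x (η a) +
      ∑ l : Fin (r + 2), (-1) ^ ((l : ℕ) + 1) *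
        η (Matrix.vecCons (E.bracket x (a l)) (l.removeNth a)) -
      E.koszul (interiorVec x η) a := by
  have c0 : (0 : Fin (r + 3)).removeNth (Fin.cons x a : Fin (r + 3) → S) = a := rfl
  have c1 : ∀ (k : Fin (r + 2)), k.succ.removeNth (Fin.cons x a : Fin (r + 3) → S) =
        (Fin.cons x (k.removeNth a) : Fin (r + 2) → S) := by
    intro k
    funext i
    refine Fin.cases ?_ (fun i => ?_) i
    · simp [Fin.removeNth_apply]
    · simp [Fin.removeNth_apply]
  have d1 : ∀ (k m : Fin (r + 1)),
      m.succ.removeNth (k.succ.castSucc.removeNth (Fin.cons x a : Fin (r + 3) → S))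
        = (Fin.cons x (m.removeNth (k.castSucc.removeNth a)) : Fin (r + 1) → S) := by
    intro k m
    funext i
    refine Fin.cases ?_ (fun i => ?_) i
    · simp [Fin.removeNth_apply]
    · simp [Fin.removeNth_apply]
  have hexp : E.koszul η (Matrix.vecCons x a) =
      ((-1) ^ ((0 : Fin (r + 3)) : ℕ) * E.anchor x (η ((0 : Fin (r + 3)).removeNth
            (Fin.cons x a : Fin (r + 3) → S))) +
        ∑ k : Fin (r + 2), (-1) ^ ((k.succ : Fin (r + 3)) : ℕ) *
          E.anchor (a k) (η (k.succ.removeNth (Fin.cons x a : Fin (r + 3) → S)))) +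
      ((∑ l ≥ (0 : Fin (r + 2)), (-1) ^ (((0 : Fin (r + 2)) : ℕ) + (l + 1)) *
          η (Matrix.vecCons (E.bracket x (a l))
            (l.removeNth ((Fin.castSucc 0).removeNth (Fin.cons x a : Fin (r + 3) → S))))) +
        ∑ k : Fin (r + 1), ∑ l ≥ k.succ, (-1) ^ (((k.succ : Fin (r + 2)) : ℕ) + (l + 1)) *
          η (Matrix.vecCons (E.bracket ((Fin.cons x a : Fin (r + 3) → S) k.succ.castSucc) (a l))
            (l.removeNth (k.succ.castSucc.removeNth (Fin.cons x a : Fin (r + 3) → S))))) := 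
    congrArg₂ (· + ·) (Fin.sum_univ_succ _) (Fin.sum_univ_succ _)
  have t4 : ∑ k : Fin (r + 1), ∑ l ≥ k.succ, (-1) ^ (((k.succ : Fin (r + 2)) : ℕ) + (l + 1)) *
          η (Matrix.vecCons (E.bracket ((Fin.cons x a : Fin (r + 3) → S) k.succ.castSucc) (a l))
            (l.removeNth (k.succ.castSucc.removeNth (Fin.cons x a : Fin (r + 3) → S)))) =
      - ∑ k : Fin (r + 1), ∑ l ≥ k, (-1) ^ ((k : ℕ) + (l + 1)) *
        interiorVec x η (Matrix.vecCons (E.bracket (a k.castSucc) (a l.succ))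
          (l.removeNth (k.castSucc.removeNth a))) := by
    rw [← Finset.sum_neg_distrib]
    refine Finset.sum_congr rfl fun k _ => ?_
    -- The indices `l ≥ k.succ` are the `m.succ` with `m ≥ k`. Shifting both indices leaves the sign
    -- unchanged; the minus sign comes from moving `x` in front of the bracket.
    rw [← Fin.map_succEmb_Ici, Finset.sum_map, ← Finset.sum_neg_distrib]
    refine Finset.sum_congr rfl fun m _ => ?_
    simp only [Fin.coe_succEmb]
    rw [d1, ← Fin.succ_castSucc, interior_apply, Form.cons_swap]
    simp only [Fin.cons_succ, Fin.val_succ]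
    have : (Fin.cons x (m.removeNth (k.castSucc.removeNth a)) : Fin (r + 1) → S) =
      Matrix.vecCons x (m.removeNth (k.castSucc.removeNth a)) := rfl
    rw [this]
    ring
  have t2 : ∑ k : Fin (r + 2), (-1) ^ ((k.succ : Fin (r + 3)) : ℕ) *
          E.anchor (a k) (η (k.succ.removeNth (Fin.cons x a : Fin (r + 3) → S))) =
      - ∑ k : Fin (r + 2), (-1) ^ (k : ℕ) * E.anchor (a k) (interiorVec x η (k.removeNth a)) := by
    rw [← Finset.sum_neg_distrib]
    refine Finset.sum_congr rfl fun k _ => ?_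
    rw [c1, Fin.val_succ, pow_succ]
    have : interiorVec x η (k.removeNth a) = η (Fin.cons x (k.removeNth a)) := rfl
    rw [this]; ring
  have t3 : ∑ l ≥ (0 : Fin (r + 2)), (-1) ^ (((0 : Fin (r + 2)) : ℕ) + (l + 1)) *
          η (Matrix.vecCons (E.bracket x (a l))
            (l.removeNth ((Fin.castSucc 0).removeNth (Fin.cons x a : Fin (r + 3) → S)))) =
      ∑ l : Fin (r + 2), (-1) ^ ((l : ℕ) + 1) *
        η (Matrix.vecCons (E.bracket x (a l)) (l.removeNth a)) := by
    have : Finset.Ici (0 : Fin (r + 2)) = Finset.univ := by ext; simp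
    rw [this]
    refine Finset.sum_congr rfl fun l _ => ?_
    rw [Fin.castSucc_zero, c0, Fin.val_zero, zero_add]
  rw [hexp, t2, t3, t4, c0]
  simp only [koszul, Fin.val_zero, pow_zero, one_mul]
  ring

lemma d_apply {q : ℕ} (η : Form C S q) (a : Fin (q + 1) → S) : E.d η a = E.koszul η a := rfl

/-- The Lie derivation of a form of positive degree, evaluated on sections. -/
lemma lieDer_succ_apply (x : S) {q : ℕ} (η : Form C S (q + 1)) (a : Fin (q + 1) → S) :
    E.lieDer x η a = E.anchor x (η a) + ∑ l : Fin (q + 1), (-1) ^ ((l : ℕ) + 1) *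
        η (Matrix.vecCons (E.bracket x (a l)) (l.removeNth a)) := by
  rw [lieDer, AlternatingMap.add_apply, interior_apply, d_apply, d_apply]
  cases q with
  | zero =>
    rw [koszul_cons_zero]
    have e : (0 : Fin 1).removeNth a = ![] := Subsingleton.elim _ _
    simp [koszul, interior_apply, e]
    ring
  | succ r => rw [koszul_cons]; ring

lemma lieDer_zero_apply (x : S) (η : Form C S 0) (a : Fin 0 → S) :
    E.lieDer x η a = E.anchor x (η a) := by
  have e : a = ![] := Subsingleton.elim _ _
  subst e
  rw [lieDer, interior_apply, d_apply]
  simp [koszul]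

/-- In the explicit formula for `L_x η` on `(y, v)`, the `l = 0` term is `-η([x, y], v)` and the
others form `L_x (i_y η)`. The remaining Cartan identities are deduced from this one by contracting
with an arbitrary section and inducting on the degree. -/
lemma lieDer_interiorVec (x y : S) {q : ℕ} (η : Form C S (q + 1)) :
    E.lieDer x (interiorVec y η) =
      interiorVec y (E.lieDer x η) + interiorVec (E.bracket x y) η := by
  ext v
  rw [AlternatingMap.add_apply, interior_apply, interior_apply, lieDer_succ_apply,
    Fin.sum_univ_succ]
  have c0 : (0 : Fin (q + 1)).removeNth (Matrix.vecCons y v) = v := rfl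
  rw [c0]
  simp only [Fin.val_zero, zero_add, pow_one, neg_mul, one_mul, Matrix.cons_val_zero]
  cases q with
  | zero => rw [lieDer_zero_apply]; simp [interior_apply]
  | succ r =>
    rw [lieDer_succ_apply]
    have : ∑ l : Fin (r + 1), (-1) ^ ((l.succ : Fin (r + 2)) + 1 : ℕ) *
        η (Matrix.vecCons (E.bracket x ((Matrix.vecCons y v : Fin (r + 2) → S) l.succ))
          (l.succ.removeNth (Matrix.vecCons y v))) =
        ∑ l : Fin (r + 1), (-1) ^ ((l : ℕ) + 1) *
          interiorVec y η (Matrix.vecCons (E.bracket x (v l)) (l.removeNth v)) := by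
      refine Finset.sum_congr rfl fun l _ => ?_
      have c1 : l.succ.removeNth (Matrix.vecCons y v : Fin (r + 2) → S) =
          (Matrix.vecCons y (l.removeNth v) : Fin (r + 1) → S) := by
        funext i
        refine Fin.cases ?_ (fun i => ?_) i
        · simp [Fin.removeNth_apply]
        · simp [Fin.removeNth_apply]
      rw [c1, interior_apply, Form.cons_swap, Fin.val_succ]
      simp only [Matrix.cons_val_succ]
      ring
    rw [this, interior_apply]; ring

lemma interiorVec_d (x : S) {q : ℕ} (η : Form C S (q + 1)) :
    interiorVec x (E.d η) = E.lieDer x η - E.d (interiorVec x η) := by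
  rw [lieDer]; abel

lemma interiorVec_d_zero (x : S) (η : Form C S 0) : interiorVec x (E.d η) = E.lieDer x η := rfl

/-- Degree zero is the compatibility of the anchor with brackets; in the inductive step the defect
is the Jacobi identity for `x, y, z`. -/
lemma lieDer_bracket (x y : S) : ∀ {q : ℕ} (η : Form C S q),
    E.lieDer (E.bracket x y) η = E.lieDer x (E.lieDer y η) - E.lieDer y (E.lieDer x η)
  | 0, η => by
    ext a
    simp only [AlternatingMap.sub_apply, lieDer_zero_apply, E.anchor_bracket]
    rfl
  | q + 1, η => by
    refine Form.ext_interior fun z => ?_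
    have h : ∀ (u : S) (ζ : Form C S (q + 1)), interiorVec z (E.lieDer u ζ) =
        E.lieDer u (interiorVec z ζ) - interiorVec (E.bracket u z) ζ := by
      intro u ζ; rw [lieDer_interiorVec]; abel
    rw [map_sub, h, h, h, h, h, lieDer_bracket x y (interiorVec z η)]
    have h2 : ∀ (u : S) {q : ℕ} (η ζ : Form C S q), E.lieDer u (η - ζ) =
        E.lieDer u η - E.lieDer u ζ := fun u q => map_sub (E.lieDerHom u q)
    rw [h2, h2, E.lieDer_interiorVec x (E.bracket y z), E.lieDer_interiorVec y (E.bracket x z),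
      E.jacobi x y z, interiorVec_add_left]
    abel

lemma lieDer_sub (x : S) {q : ℕ} (η ζ : Form C S q) :
    E.lieDer x (η - ζ) = E.lieDer x η - E.lieDer x ζ := map_sub (E.lieDerHom x q) η ζ

lemma d_sub {q : ℕ} (η ζ : Form C S q) : E.d (η - ζ) = E.d η - E.d ζ :=
  map_sub (AddMonoidHom.mk' (E.d (q := q)) E.d_add) η ζ

lemma d_zero {q : ℕ} : E.d (0 : Form C S q) = 0 :=
  map_zero (AddMonoidHom.mk' (E.d (q := q)) E.d_add)

lemma lieDer_d (x : S) : ∀ {q : ℕ} (η : Form C S q), E.lieDer x (E.d η) = E.d (E.lieDer x η)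
  | 0, η => by
    refine Form.ext_interior fun y => ?_
    have h := E.lieDer_interiorVec x y (E.d η)
    rw [interiorVec_d_zero, interiorVec_d_zero, lieDer_bracket] at h
    rw [interiorVec_d_zero]
    rw [eq_sub_of_add_eq h.symm]; abel
  | q + 1, η => by
    refine Form.ext_interior fun y => ?_
    have h := E.lieDer_interiorVec x y (E.d η)
    have h2 := E.lieDer_interiorVec x y η
    rw [interiorVec_d, interiorVec_d, lieDer_bracket, lieDer_sub,
      lieDer_d x (interiorVec y η), h2, d_add] at h
    rw [interiorVec_d]
    rw [eq_sub_of_add_eq h.symm]; abel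

lemma d_d : ∀ {q : ℕ} (η : Form C S q), E.d (E.d η) = 0
  | 0, η => by
    refine Form.ext_interior fun y => ?_
    rw [interiorVec_d, interiorVec_d_zero, lieDer_d, sub_self, map_zero]
  | q + 1, η => by
    refine Form.ext_interior fun y => ?_
    rw [interiorVec_d, interiorVec_d, d_sub, d_d (interiorVec y η), lieDer_d]
    simp

end LieAlgebroid
end TwistedPoisson

namespace TwistedPoisson

/-! ### Algebraic consequences of the existence of local frames. -/

section Frames

/-- The module `S` is reflexive and admits enough local frames with `N` elements: a function is
zero as soon as it is annihilated, up to powers, by all the functions `χ` on the support of which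
there is a frame `e` with dual frame `ε / χ`. -/
structure HasLocalFrames (C S : Type*) [CommRing C] [AddCommGroup S] [Module C S] (N : ℕ) :
    Prop where
  reflexive : Function.Bijective (Module.Dual.eval C S)
  separating : ∀ c : C, (∀ (χ : C) (e : Fin N → S) (ε : Fin N → Module.Dual C S),
    (∀ s, χ • s = ∑ i, ε i s • e i) → ∃ k, χ ^ k * c = 0) → c = 0

variable {C S : Type*} [CommRing C] [AddCommGroup S] [Module C S] {N : ℕ}

lemma HasLocalFrames.ext_dual (hS : HasLocalFrames C S N) {x y : S}
    (h : ∀ γ : Module.Dual C S, γ x = γ y) : x = y :=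
  hS.reflexive.1 (LinearMap.ext h)

/-- There are no nonzero forms of degree larger than the rank. -/
lemma HasLocalFrames.form_eq_zero (hS : HasLocalFrames C S N) {q : ℕ} (hq : N < q)
    (η : Form C S q) : η = 0 := by
  ext a
  refine hS.separating _ fun χ e ε h => ⟨q, ?_⟩
  -- Pulled back to `C^N` by the frame, the form vanishes, since `q > N` basis vectors cannot be
  -- distinct. At the coordinates of `a` the pullback takes the value `η(χ a) = χ^q η(a)`.
  have h0 : η.compLinearMap (Fintype.linearCombination C e) = 0 := by
    refine Module.Basis.ext_alternating (Pi.basisFun C (Fin N)) fun v hv => ?_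
    have := Fintype.card_le_of_injective v hv
    simp at this
    omega
  have h1 := congrArg (fun F => F (fun i j => ε j (a i))) h0
  simp only [AlternatingMap.compLinearMap_apply, Fintype.linearCombination_apply, ← h,
    AlternatingMap.zero_apply] at h1
  have h2 := η.toMultilinearMap.map_smul_univ (fun _ => χ) a
  simp only [AlternatingMap.coe_multilinearMap, Finset.prod_const, Finset.card_univ,
    Fintype.card_fin, smul_eq_mul] at h2
  rw [← h2]; exact h1

/-- The trace formula `i_P τ = -(1/2) ∑ τ(e_i, P^♯ ε_i)`, cleared of the denominators 2 and `χ`. Its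
right-hand side involves `P` only through `P^♯`. -/
lemma interiorBi_apply_sum {χ : C} {e : Fin N → S} {ε : Fin N → Module.Dual C S}
    (h : ∀ s, χ • s = ∑ i, ε i s • e i) (P : ⋀[C]^2 S) (τ : Form C S 2) :
    2 * χ * interiorBi P τ ![] = - ∑ i, τ ![e i, sharp P (ε i)] := by
  have hτ : ∀ x y, χ * τ ![x, y] = ∑ i, ε i x * τ ![e i, y] := by
    intro x y
    have : flat τ (χ • x) y = flat τ (∑ i, ε i x • e i) y := by rw [h]
    simpa [flat_apply, LinearMap.sum_apply] using this
  induction P using bivector_induction with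
  | h0 =>
    have : ∀ x, τ ![x, 0] = 0 := fun x => τ.map_coord_zero 1 rfl
    simp [this]
  | hw x y =>
    rw [interiorBi_wedge, interior_apply, interior_apply]
    have h1 : ∀ i, τ ![e i, sharp (wedgeVec x y) (ε i)] =
        ε i x * τ ![e i, y] - ε i y * τ ![e i, x] := by
      intro i
      rw [sharp_wedge, ← flat_apply, map_sub, map_smul, map_smul, flat_apply, flat_apply]; rfl
    simp only [h1, Finset.sum_sub_distrib, ← hτ]
    rw [Form.pair_swap τ x y]; ring
  | ha P Q hP hQ =>
    have h1 : ∀ i, τ ![e i, sharp (P + Q) (ε i)] =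
        τ ![e i, sharp P (ε i)] + τ ![e i, sharp Q (ε i)] := by
      intro i
      rw [map_add, LinearMap.add_apply, ← flat_apply, map_add, flat_apply, flat_apply]
    simp only [h1, Finset.sum_add_distrib]
    simp only [map_add, LinearMap.add_apply, AlternatingMap.add_apply,
      mul_add, hP, hQ]
    ring

lemma isUnit_two (C : Type*) [CommRing C] [Algebra ℝ C] : IsUnit (2 : C) := by
  have := (IsUnit.mk0 (2 : ℝ) two_ne_zero).map (algebraMap ℝ C)
  rwa [map_ofNat] at this

/-- The pairing of a bivector with a `2`-form only depends on the map `P^♯`. -/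
lemma HasLocalFrames.interiorBi_congr [Algebra ℝ C] (hS : HasLocalFrames C S N) {P Q : ⋀[C]^2 S}
    (h : ∀ α, sharp P α = sharp Q α) (τ : Form C S 2) :
    interiorBi P τ ![] = interiorBi Q τ ![] := by
  rw [← sub_eq_zero]
  refine hS.separating _ fun χ e ε hχ => ⟨1, ?_⟩
  refine (isUnit_two C).mul_left_cancel ?_
  have h1 := interiorBi_apply_sum hχ P τ
  have h2 := interiorBi_apply_sum hχ Q τ
  simp only [h] at h1
  linear_combination h1 - h2

end Frames

/-! ### The Gerstenhaber bracket evaluated on 1-forms. -/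

section Schouten
variable {C S : Type*} [CommRing C] [Algebra ℝ C] [AddCommGroup S] [Module C S]

omit [Algebra ℝ C] in
lemma evalForm_ιMulti {q : ℕ} (f : Fin q → Module.Dual C S) (v : Fin q → S) :
    evalForm (exteriorPower.ιMulti C q f) v = (Matrix.of fun i j => f j (v i)).det := by
  change exteriorPower.pairingDual C S q (exteriorPower.ιMulti C q f)
    (exteriorPower.ιMulti C q v) = _
  rw [exteriorPower.pairingDual_ιMulti_ιMulti]

omit [Algebra ℝ C] in
lemma evalForm_ιMulti_three (α β γ : Module.Dual C S) (x y z : S) :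
    evalForm (exteriorPower.ιMulti C 3 ![α, β, γ]) ![x, y, z] =
      α x * β y * γ z - α x * γ y * β z - β x * α y * γ z + β x * γ y * α z
        + γ x * α y * β z - γ x * β y * α z := by
  rw [evalForm_ιMulti, Matrix.det_fin_three]
  simp

/-- The value of the component of degree three of a multivector on three `1`-forms. -/
noncomputable def trivectorEval (α β γ : Module.Dual C S) : ExteriorAlgebra C S →ₗ[C] C :=
  ExteriorAlgebra.liftAlternating (R := C) (fun i => match i with
    | 3 => evalForm (exteriorPower.ιMulti C 3 ![α, β, γ])
    | _ => 0)

omit [Algebra ℝ C] in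
lemma trivectorEval_ιMulti (α β γ : Module.Dual C S) (x y z : S) :
    trivectorEval α β γ (ExteriorAlgebra.ιMulti C 3 ![x, y, z]) =
      α x * β y * γ z - α x * γ y * β z - β x * α y * γ z + β x * γ y * α z
        + γ x * α y * β z - γ x * β y * α z := by
  rw [trivectorEval, ExteriorAlgebra.liftAlternating_apply_ιMulti]
  exact evalForm_ιMulti_three α β γ x y z

omit [Algebra ℝ C] in
lemma trivector_ext {L : Type*} [AddCommGroup L] [Module C L]
    {f g : ⋀[C]^3 (Module.Dual C S) →ₗ[C] L}
    (h : ∀ a b c, f (exteriorPower.ιMulti C 3 ![a, b, c]) =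
      g (exteriorPower.ιMulti C 3 ![a, b, c])) : f = g := by
  apply exteriorPower.linearMap_ext
  ext v
  have : v = ![v 0, v 1, v 2] := by ext i; fin_cases i <;> rfl
  rw [this]; exact h _ _ _

/-- The sign is `(-1)³`: `π^♯` is skew and is transposed three times. -/
lemma trivectorEval_map_sharp (π : ⋀[C]^2 S) (ψ : ⋀[C]^3 (Module.Dual C S))
    (α β γ : Module.Dual C S) :
    trivectorEval α β γ (exteriorPower.map 3 (sharp π) ψ : ExteriorAlgebra C S) =
      - evalForm ψ ![sharp π α, sharp π β, sharp π γ] := by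
  let f : ⋀[C]^3 (Module.Dual C S) →ₗ[C] C :=
    trivectorEval α β γ ∘ₗ (⋀[C]^3 S).subtype ∘ₗ exteriorPower.map 3 (sharp π)
  let g : ⋀[C]^3 (Module.Dual C S) →ₗ[C] C :=
    { toFun := fun ψ => - evalForm ψ ![sharp π α, sharp π β, sharp π γ]
      map_add' := by intros; simp; ring
      map_smul' := by intros; simp }
  have : f = g := by
    apply trivector_ext
    intro a b c
    change trivectorEval α β γ ((exteriorPower.map 3 (sharp π)
      (exteriorPower.ιMulti C 3 ![a, b, c]) : ⋀[C]^3 S) : ExteriorAlgebra C S) =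
      - evalForm (exteriorPower.ιMulti C 3 ![a, b, c]) ![sharp π α, sharp π β, sharp π γ]
    rw [exteriorPower.map_apply_ιMulti, exteriorPower.ιMulti_apply_coe]
    have e : (sharp π) ∘ ![a, b, c] = ![sharp π a, sharp π b, sharp π c] := by
      ext i; fin_cases i <;> rfl
    rw [e, trivectorEval_ιMulti, evalForm_ιMulti_three]
    simp only [dual_sharp_swap π a, dual_sharp_swap π b, dual_sharp_swap π c]
    ring
  exact congrArg (fun F => F ψ) this

namespace LieAlgebroid
variable (E : LieAlgebroid C S)

/-- The Gerstenhaber bracket of bivectors is the symmetrization of this expression. -/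
noncomputable def schoutenHalf (P Q : ⋀[C]^2 S) (α β γ : Module.Dual C S) : C :=
  γ (E.bracket (sharp P α) (sharp Q β)) + α (E.bracket (sharp P β) (sharp Q γ))
    + β (E.bracket (sharp P γ) (sharp Q α))
    + E.anchor (sharp P α) (β (sharp Q γ)) + E.anchor (sharp P β) (γ (sharp Q α))
    + E.anchor (sharp P γ) (α (sharp Q β))

lemma schoutenHalf_add_left (P P' Q : ⋀[C]^2 S) (α β γ : Module.Dual C S) :
    E.schoutenHalf (P + P') Q α β γ = E.schoutenHalf P Q α β γ + E.schoutenHalf P' Q α β γ := by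
  simp only [schoutenHalf, map_add, LinearMap.add_apply, AddMonoidHom.add_apply,
    Derivation.add_apply]
  ring

lemma schoutenHalf_add_right (P Q Q' : ⋀[C]^2 S) (α β γ : Module.Dual C S) :
    E.schoutenHalf P (Q + Q') α β γ = E.schoutenHalf P Q α β γ + E.schoutenHalf P Q' α β γ := by
  simp only [schoutenHalf, map_add, LinearMap.add_apply]
  ring

lemma schouten_zero_left (Q : ⋀[C]^2 S) : E.schouten 0 Q = 0 := by
  rw [schouten, map_zero]; rfl

lemma schouten_zero_right (P : ⋀[C]^2 S) : E.schouten P 0 = 0 :=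
  map_zero (AddMonoidHom.mk' (E.schouten P) (E.schouten_add_right P))

/-- Both sides are biadditive in `P` and `Q`, so decomposable bivectors suffice. There the anchor
terms of `schoutenHalf` cancel the derivatives of coefficients such as `α x` produced by the Leibniz
rule. -/
lemma trivectorEval_schouten (P Q : ⋀[C]^2 S) (α β γ : Module.Dual C S) :
    trivectorEval α β γ (E.schouten P Q) =
      E.schoutenHalf P Q α β γ + E.schoutenHalf Q P α β γ := by
  induction P using bivector_induction with
  | h0 => rw [schouten_zero_left]; simp [schoutenHalf]
  | ha P P' hP hP' =>
    rw [schouten_add_left, map_add, hP, hP', schoutenHalf_add_left, schoutenHalf_add_right]; ring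
  | hw x y =>
    induction Q using bivector_induction with
    | h0 => rw [schouten_zero_right]; simp [schoutenHalf]
    | ha Q Q' hQ hQ' =>
      rw [schouten_add_right, map_add, hQ, hQ', schoutenHalf_add_left, schoutenHalf_add_right]
      ring
    | hw z w =>
      rw [schouten_wedge_wedge]
      simp only [map_add, map_sub, trivectorEval_ιMulti, schoutenHalf, sharp_wedge,
        AddMonoidHom.sub_apply, E.leibniz, E.bracket_smul_left, map_smul, smul_eq_mul,
        Derivation.sub_apply, Derivation.smul_apply, Derivation.leibniz,
        E.bracket_neg_swap z x, E.bracket_neg_swap z y, E.bracket_neg_swap w x,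
        E.bracket_neg_swap w y, map_neg]
      ring

end LieAlgebroid
end Schouten
end TwistedPoisson

namespace TwistedPoisson

/-! ### The Lie algebroid structure on `A^*` and the cocycle identity for `modularFun`. -/

section TwistedStructure
variable {C S : Type*} [CommRing C] [Algebra ℝ C] [AddCommGroup S] [Module C S]

lemma dual_sharp_self (P : ⋀[C]^2 S) (α : Module.Dual C S) : α (sharp P α) = 0 := by
  refine (isUnit_two C).mul_left_cancel ?_
  linear_combination dual_sharp_swap P α α

omit [Algebra ℝ C] in
lemma interiorBi_interiorVec (P : ⋀[C]^2 S) (z : S) {q : ℕ} (η : Form C S (q + 3)) :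
    interiorBi P (interiorVec z η) = interiorVec z (interiorBi P η) := by
  induction P using bivector_induction with
  | h0 => simp
  | hw x y =>
    rw [interiorBi_wedge, interiorBi_wedge, interiorVec_anticomm y z, map_neg,
      interiorVec_anticomm x z, neg_neg]
  | ha P Q hP hQ => simp only [map_add, LinearMap.add_apply, hP, hQ]

omit [Algebra ℝ C] in
-- Up to a constant, both sides are the trace of `ζ^♭ P^♯ η^♭ Q^♯`, read in two cyclic orders. For
-- `P = Q` this makes the pairing of `(∧²P^♯) η` with `ζ` symmetric in the two 2-forms.
lemma interiorBi_bivectorDer_swap (P Q : ⋀[C]^2 S) (η ζ : Form C S 2) :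
    interiorBi (bivectorDer (sharp P ∘ₗ flat η) Q) ζ ![] =
      interiorBi (bivectorDer (sharp Q ∘ₗ flat ζ) P) η ![] := by
  induction P using bivector_induction with
  | h0 => simp
  | ha P P' hP hP' =>
    simp only [map_add, LinearMap.add_apply, AlternatingMap.add_apply, LinearMap.add_comp, hP, hP']
  | hw x y =>
    induction Q using bivector_induction with
    | h0 => simp
    | ha Q Q' hQ hQ' =>
      simp only [map_add, LinearMap.add_apply, AlternatingMap.add_apply, LinearMap.add_comp, hQ,
        hQ']
    | hw z w =>
      have h : ∀ (u v : S) (θ : Form C S 2), interiorBi (wedgeVec u v) θ ![] = flat θ v u := by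
        intro u v θ; rw [interiorBi_wedge, flat_apply]; rfl
      have hs : ∀ (θ : Form C S 2) (u v : S), flat θ u v = - flat θ v u := by
        intro θ u v; rw [flat_apply, flat_apply, Form.pair_swap]
      simp only [bivectorDer_wedge, map_add, LinearMap.add_apply, AlternatingMap.add_apply, h,
        LinearMap.comp_apply, sharp_wedge, map_sub, map_smul, LinearMap.sub_apply,
        LinearMap.smul_apply, AlternatingMap.sub_apply, AlternatingMap.smul_apply, smul_eq_mul]
      rw [hs η z x, hs η z y, hs η w x, hs η w y, hs ζ w x, hs ζ w y]
      ring

lemma interiorBi_wedgeTwoSharp_swap (P : ⋀[C]^2 S) (η ζ : Form C S 2) :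
    interiorBi (wedgeTwoSharp P η) ζ ![] = interiorBi (wedgeTwoSharp P ζ) η ![] := by
  rw [wedgeTwoSharp_apply, wedgeTwoSharp_apply, map_smul, map_smul, LinearMap.smul_apply,
    LinearMap.smul_apply, AlternatingMap.smul_apply, AlternatingMap.smul_apply,
    interiorBi_bivectorDer_swap]

namespace LieAlgebroid
variable (E : LieAlgebroid C S)

lemma lieDer_oneForm_apply (x : S) (β : Module.Dual C S) (v : Fin 1 → S) :
    E.lieDer x (oneForm β) v = E.anchor x (β (v 0)) - β (E.bracket x (v 0)) := by
  rw [lieDer_succ_apply]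
  simp [oneForm_apply, sub_eq_add_neg]

lemma d_interiorVec_oneForm (x : S) (α : Module.Dual C S) :
    E.d (interiorVec x (oneForm α)) = oneForm (E.dFun (α x)) := rfl

lemma lieDer_interiorBi (x : S) (P : ⋀[C]^2 S) {q : ℕ} (η : Form C S (q + 2)) :
    E.lieDer x (interiorBi P η) =
      interiorBi (E.lieBivector x P) η + interiorBi P (E.lieDer x η) := by
  induction P using bivector_induction with
  | h0 =>
    simp only [map_zero, LinearMap.zero_apply, add_zero]
    exact map_zero (E.lieDerHom x q)
  | hw y z =>
    rw [lieBivector_wedge, map_add, LinearMap.add_apply]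
    simp only [interiorBi_wedge, lieDer_interiorVec, map_add]
    abel
  | ha P Q hP hQ =>
    simp only [map_add, LinearMap.add_apply, lieDer_add, hP, hQ]; abel

lemma sharp_lieBivector (x : S) (P : ⋀[C]^2 S) (β : Module.Dual C S) :
    sharp (E.lieBivector x P) β =
      E.bracket x (sharp P β) - sharp P (oneForm.symm (E.lieDer x (oneForm β))) := by
  induction P using bivector_induction with
  | h0 => simp
  | hw y z =>
    rw [lieBivector_wedge, map_add, LinearMap.add_apply]
    simp only [sharp_wedge, oneForm_symm_apply, lieDer_oneForm_apply, map_sub, E.leibniz,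
      Matrix.cons_val_zero, sub_smul]
    abel
  | ha P Q hP hQ => simp only [map_add, LinearMap.add_apply, hP, hQ]; abel

variable (π : ⋀[C]^2 S) (ψ : ⋀[C]^3 (Module.Dual C S))

/-- The `2`-form `d_A α - i_{π^♯ α} ψ`. -/
noncomputable def twistedD (α : Module.Dual C S) : Form C S 2 :=
  E.d (oneForm α) - interiorVec (sharp π α) (evalForm ψ)

/-- Expanding `L_{π^♯β} α` by Cartan's formula, its exact part cancels `d_A (π(α, β))`, because `π`
is skew. What remains is asymmetric in `α` and `β`, but it consists only of `L` and `i` and is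
convenient for formal computation. -/
lemma oneForm_dualBracket (α β : Module.Dual C S) :
    oneForm (E.dualBracket π ψ α β) = E.lieDer (sharp π α) (oneForm β)
      - interiorVec (sharp π β) (E.twistedD π ψ α) := by
  have h : E.lieDer (sharp π β) (oneForm α) =
      interiorVec (sharp π β) (E.d (oneForm α)) - oneForm (E.dFun (β (sharp π α))) := by
    rw [lieDer, d_interiorVec_oneForm, dual_sharp_swap π β α]
    have : E.dFun (-(β (sharp π α))) = - E.dFun (β (sharp π α)) := by ext; simp
    rw [this, map_neg]; abel
  rw [dualBracket, map_add, map_sub, map_sub, LinearEquiv.apply_symm_apply,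
    LinearEquiv.apply_symm_apply, LinearEquiv.apply_symm_apply, h, twistedD, map_sub]
  abel

lemma dualBracket_apply (α β : Module.Dual C S) (z : S) :
    E.dualBracket π ψ α β z = E.anchor (sharp π α) (β z) - β (E.bracket (sharp π α) z)
      - E.anchor (sharp π β) (α z) + α (E.bracket (sharp π β) z)
      - E.anchor z (β (sharp π α)) + evalForm ψ ![sharp π α, sharp π β, z] := by
  rw [dualBracket]
  simp only [LinearMap.add_apply, LinearMap.sub_apply, oneForm_symm_apply, lieDer_oneForm_apply,
    Matrix.cons_val_zero, dFun_apply, interior_apply]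
  ring

lemma dualBracket_add_left (α α' β : Module.Dual C S) :
    E.dualBracket π ψ (α + α') β = E.dualBracket π ψ α β + E.dualBracket π ψ α' β := by
  ext z
  simp only [dualBracket_apply, LinearMap.add_apply, map_add, AddMonoidHom.add_apply,
    Derivation.add_apply]
  have h : evalForm ψ ![sharp π α + sharp π α', sharp π β, z] =
      evalForm ψ ![sharp π α, sharp π β, z] + evalForm ψ ![sharp π α', sharp π β, z] :=
    congrArg (fun F => F ![sharp π β, z])
      ((evalForm ψ).curryLeft.map_add (sharp π α) (sharp π α'))
  rw [h]
  ring

lemma dualBracket_add_right (α β β' : Module.Dual C S) :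
    E.dualBracket π ψ α (β + β') = E.dualBracket π ψ α β + E.dualBracket π ψ α β' := by
  refine oneForm.injective ?_
  simp only [map_add, oneForm_dualBracket, lieDer_add, interiorVec_add_left]
  abel

lemma dualBracket_self (α : Module.Dual C S) : E.dualBracket π ψ α α = 0 := by
  ext z
  rw [dualBracket_apply, dual_sharp_self, map_zero]
  have : evalForm ψ ![sharp π α, sharp π α, z] = 0 :=
    (evalForm ψ).map_eq_zero_of_eq _ (i := 0) (j := 1) rfl (by simp)
  rw [this, LinearMap.zero_apply]; ring

lemma dualBracket_smul (α β : Module.Dual C S) (f : C) :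
    E.dualBracket π ψ α (f • β) =
      f • E.dualBracket π ψ α β + E.anchor (sharp π α) f • β := by
  refine oneForm.injective ?_
  simp only [map_add, map_smul, oneForm_dualBracket, lieDer_smul, interiorVec_smul_left, smul_sub]
  abel

variable {E π ψ} {N : ℕ} 

/-- The equation for `[π, π]` paired with three 1-forms; for equal arguments the symmetrization
doubles `schoutenHalf`, which absorbs the factor `1/2`. -/
lemma IsTwistedPoisson.schoutenHalf_eq (hE : E.IsTwistedPoisson π ψ) (α β γ : Module.Dual C S) :
    E.schoutenHalf π π α β γ = - evalForm ψ ![sharp π α, sharp π β, sharp π γ] := by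
  have h := congrArg (trivectorEval α β γ) hE.2
  rw [map_smul, trivectorEval_map_sharp, trivectorEval_schouten, smul_eq_mul] at h
  have h2 : algebraMap ℝ C (1 / 2) * 2 = 1 := by
    rw [← map_ofNat (algebraMap ℝ C), ← map_mul]; norm_num
  linear_combination h - E.schoutenHalf π π α β γ * h2

/-- `π^♯` is a morphism of brackets. -/
lemma IsTwistedPoisson.sharp_dualBracket (hE : E.IsTwistedPoisson π ψ)
    (hS : HasLocalFrames C S N) (α β : Module.Dual C S) :
    sharp π (E.dualBracket π ψ α β) = E.bracket (sharp π α) (sharp π β) := by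
  refine hS.ext_dual fun γ => ?_
  have h := hE.schoutenHalf_eq α β γ
  rw [schoutenHalf, E.bracket_neg_swap (sharp π γ) (sharp π α), map_neg] at h
  -- Transposing `π^♯` evaluates the bracket at `z = π^♯ γ`. Up to sign, its terms are then all
  -- those of `h` except `γ([π^♯α, π^♯β])`.
  rw [dual_sharp_swap, dualBracket_apply, dual_sharp_swap π γ α, dual_sharp_swap π α β, map_neg,
    map_neg]
  linear_combination -h

/-- Apply `d_A` to `oneForm_dualBracket`. Closedness of `ψ` turns `d_A i_y ψ` into `L_y ψ`, and the
commutator `[L_x, i_y] = i_{[x,y]}` absorbs the term `i_{π^♯[α,β]} ψ`, as `π^♯` preserves brackets.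
-/
lemma IsTwistedPoisson.twistedD_dualBracket (hE : E.IsTwistedPoisson π ψ)
    (hS : HasLocalFrames C S N) (α β : Module.Dual C S) :
    E.twistedD π ψ (E.dualBracket π ψ α β) =
      E.lieDer (sharp π α) (E.twistedD π ψ β) - E.lieDer (sharp π β) (E.twistedD π ψ α) := by
  have h1 : ∀ x y, E.d (interiorVec x (interiorVec y (evalForm ψ))) =
      E.lieDer x (interiorVec y (evalForm ψ)) - interiorVec x (E.lieDer y (evalForm ψ)) := by
    intro x y
    have h2 : E.d (interiorVec y (evalForm ψ)) = E.lieDer y (evalForm ψ) := by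
      rw [lieDer, hE.1, map_zero, zero_add]
    rw [← h2, interiorVec_d]; abel
  have h4 := E.lieDer_interiorVec (sharp π α) (sharp π β) (evalForm ψ)
  have h5 : E.d (interiorVec (sharp π β) (E.d (oneForm α))) =
      E.lieDer (sharp π β) (E.d (oneForm α)) := by
    rw [lieDer, d_d, map_zero, zero_add]
  rw [twistedD, hE.sharp_dualBracket hS, oneForm_dualBracket, d_sub, ← lieDer_d, twistedD, map_sub,
    d_sub, h1, h5, twistedD, lieDer_sub, lieDer_sub, h4]
  abel

/-- Once `π^♯` and `twistedD` are known on brackets, both sides are words in `L` and `i`, which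
agree by the commutators `[L_x, L_y]` and `[L_x, i_y]`. -/
lemma IsTwistedPoisson.dualBracket_jacobi (hE : E.IsTwistedPoisson π ψ)
    (hS : HasLocalFrames C S N) (α β γ : Module.Dual C S) :
    E.dualBracket π ψ α (E.dualBracket π ψ β γ) =
      E.dualBracket π ψ (E.dualBracket π ψ α β) γ +
        E.dualBracket π ψ β (E.dualBracket π ψ α γ) := by
  refine oneForm.injective ?_
  rw [map_add]
  simp only [oneForm_dualBracket, hE.sharp_dualBracket hS, hE.twistedD_dualBracket hS, lieDer_sub,
    lieDer_interiorVec, lieDer_bracket, map_sub]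
  abel

variable (E) in
/-- The Lie algebroid structure on `A^*` defined by a twisted Poisson structure. -/
noncomputable def dualAlgebroid (hE : E.IsTwistedPoisson π ψ) (hS : HasLocalFrames C S N) :
    LieAlgebroid C (Module.Dual C S) where
  anchor := E.anchor ∘ₗ sharp π
  bracket := AddMonoidHom.mk'
    (fun α => AddMonoidHom.mk' (E.dualBracket π ψ α) (E.dualBracket_add_right π ψ α))
    (fun α α' => by ext1 β; exact E.dualBracket_add_left π ψ α α' β)
  bracket_self := E.dualBracket_self π ψ
  jacobi := hE.dualBracket_jacobi hS
  leibniz := E.dualBracket_smul π ψ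
  anchor_bracket α β := by
    change E.anchor (sharp π (E.dualBracket π ψ α β)) = _
    rw [hE.sharp_dualBracket hS, E.anchor_bracket]; rfl

variable (E π ψ) in
/-- The function `⟨α, Y_{π,ψ}⟩ - i_π d_A α`. -/
noncomputable def modularFun (α : Module.Dual C S) : C :=
  - interiorBi π (E.twistedD π ψ α) ![]

lemma modularFun_eq (α : Module.Dual C S) :
    E.modularFun π ψ α = α (sectionY π ψ) - E.interiorPiD π α := by
  rw [modularFun, twistedD, map_sub, interiorBi_interiorVec, sectionY, dual_sharp_swap,
    contractPsi, interiorPiD]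
  simp only [LinearMap.neg_apply, oneForm_symm_apply, AlternatingMap.sub_apply, interior_apply]
  ring_nf

/-- One has `[π^♯α, π]^♯ β = [π^♯α, π^♯β] - π^♯ L_{π^♯α} β`, and `L_{π^♯α} β = [α, β] + i_{π^♯β}
ω_α` with `ω_α` the form `twistedD`. The two brackets cancel. Equality of the sharp maps is all that
`interiorBi_congr` needs. -/
lemma IsTwistedPoisson.sharp_lieBivector (hE : E.IsTwistedPoisson π ψ)
    (hS : HasLocalFrames C S N) (α β : Module.Dual C S) :
    sharp (E.lieBivector (sharp π α) π) β = sharp (wedgeTwoSharp π (E.twistedD π ψ α)) β := by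
  have h : oneForm.symm (E.lieDer (sharp π α) (oneForm β)) = E.dualBracket π ψ α β +
      oneForm.symm (interiorVec (sharp π β) (E.twistedD π ψ α)) := by
    refine oneForm.injective ?_
    rw [map_add, LinearEquiv.apply_symm_apply, LinearEquiv.apply_symm_apply, oneForm_dualBracket]
    abel
  rw [LieAlgebroid.sharp_lieBivector, h, map_add, hE.sharp_dualBracket hS, sub_add_cancel_left]
  refine hS.ext_dual fun γ => ?_
  rw [sharp_wedgeTwoSharp, map_neg, dual_sharp_swap, neg_neg, oneForm_symm_apply, interior_apply]

/-- Differentiating `-i_π ω_β` along `π^♯α` gives a term in `[π^♯α, π]` and a term in `L_{π^♯α}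
ω_β`. The first is symmetric in `α` and `β` and drops out of the difference; the second ones combine
to `-i_π ω_{[α,β]}`. -/
lemma IsTwistedPoisson.modularFun_dualBracket (hE : E.IsTwistedPoisson π ψ)
    (hS : HasLocalFrames C S N) (α β : Module.Dual C S) :
    E.modularFun π ψ (E.dualBracket π ψ α β) =
      E.anchor (sharp π α) (E.modularFun π ψ β) - E.anchor (sharp π β) (E.modularFun π ψ α) := by
  have h : ∀ α β, E.anchor (sharp π α) (E.modularFun π ψ β) =
      - interiorBi (wedgeTwoSharp π (E.twistedD π ψ α)) (E.twistedD π ψ β) ![]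
        - interiorBi π (E.lieDer (sharp π α) (E.twistedD π ψ β)) ![] := by
    intro α β
    rw [modularFun, map_neg, ← lieDer_zero_apply, lieDer_interiorBi, AlternatingMap.add_apply,
      hS.interiorBi_congr (hE.sharp_lieBivector hS α)]
    ring
  rw [h, h, interiorBi_wedgeTwoSharp_swap π (E.twistedD π ψ β), modularFun,
    hE.twistedD_dualBracket hS, map_sub, AlternatingMap.sub_apply]
  ring

end LieAlgebroid
end TwistedStructure
end TwistedPoisson

namespace TwistedPoisson

/-! ### The operators `D^∂` on forms of top degree. -/

section TopForms
variable {C S : Type*} [CommRing C] [AddCommGroup S] [Module C S]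

lemma wedge_add {q : ℕ} (α : Module.Dual C S) (η ζ : Form C S q) :
    wedge α (η + ζ) = wedge α η + wedge α ζ := by
  ext v
  simp [wedge, AlternatingMap.alternatizeUncurryFin_apply, Finset.sum_add_distrib]

lemma wedge_smul {q : ℕ} (α : Module.Dual C S) (f : C) (η : Form C S q) :
    wedge α (f • η) = f • wedge α η := by
  ext v
  simp only [wedge, AlternatingMap.alternatizeUncurryFin_apply, LinearMap.smulRight_apply,
    AlternatingMap.smul_apply, smul_eq_mul, Finset.mul_sum, zsmul_eq_mul]
  exact Finset.sum_congr rfl fun i _ => by ring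

lemma wedge_add_left {q : ℕ} (α β : Module.Dual C S) (η : Form C S q) :
    wedge (α + β) η = wedge α η + wedge β η := by
  ext v
  simp [wedge, AlternatingMap.alternatizeUncurryFin_apply, Finset.sum_add_distrib, add_mul]

lemma wedge_smul_left {q : ℕ} (f : C) (α : Module.Dual C S) (η : Form C S q) :
    wedge (f • α) η = f • wedge α η := by
  ext v
  simp only [wedge, AlternatingMap.alternatizeUncurryFin_apply, LinearMap.smulRight_apply,
    AlternatingMap.smul_apply, LinearMap.smul_apply, smul_eq_mul, Finset.mul_sum, zsmul_eq_mul]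
  exact Finset.sum_congr rfl fun i _ => by ring

lemma wedge_zero {q : ℕ} (α : Module.Dual C S) : wedge α (0 : Form C S q) = 0 := by
  simpa using wedge_smul α 0 (0 : Form C S q)

lemma wedge_neg {q : ℕ} (α : Module.Dual C S) (η : Form C S q) :
    wedge α (-η) = - wedge α η := by
  ext v
  simp [wedge, AlternatingMap.alternatizeUncurryFin_apply]

lemma wedge_sub {q : ℕ} (α : Module.Dual C S) (η ζ : Form C S q) :
    wedge α (η - ζ) = wedge α η - wedge α ζ := by
  rw [sub_eq_add_neg, wedge_add, wedge_neg, sub_eq_add_neg]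

variable {q : ℕ}

/-- Contract `α ∧ μ = 0` with `x`. This converts every interior product inside `α ∧ ∂μ` into a
scalar. -/
lemma HasLocalFrames.wedge_interiorVec (hS : HasLocalFrames C S (q + 1)) (α : Module.Dual C S)
    (x : S) (μ : Form C S (q + 1)) : wedge α (interiorVec x μ) = α x • μ := by
  have h := interior_wedge α μ x
  rw [hS.form_eq_zero (Nat.lt_succ_self _) (wedge α μ), map_zero, eq_comm, sub_eq_zero] at h
  exact h.symm

lemma HasLocalFrames.wedge_wedge_interiorBi (hS : HasLocalFrames C S (q + 2))
    (α ξ : Module.Dual C S) (x y : S) (μ : Form C S (q + 2)) :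
    wedge α (wedge ξ (interiorBi (wedgeVec x y) μ)) = (ξ x * α y - ξ y * α x) • μ := by
  have h : wedge ξ (interiorBi (wedgeVec x y) μ) =
      ξ x • interiorVec y μ - ξ y • interiorVec x μ := by
    rw [interiorBi_wedge]
    have h1 := interior_wedge ξ (interiorVec y μ) x
    rw [hS.wedge_interiorVec, map_smul] at h1
    rw [h1]; abel
  rw [h, wedge_sub, wedge_smul, wedge_smul, hS.wedge_interiorVec, hS.wedge_interiorVec, smul_smul,
    smul_smul, ← sub_smul]

lemma bivectorDer_smulRight (b : Module.Dual C S) (v : S) (P : ⋀[C]^2 S) :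
    bivectorDer (b.smulRight v) P = wedgeVec v (sharp P b) := by
  induction P using bivector_induction with
  | h0 => simp
  | hw x y =>
    rw [bivectorDer_wedge, sharp_wedge]
    simp only [LinearMap.smulRight_apply, map_smul, map_sub, LinearMap.smul_apply]
    rw [wedgeVec_swap x v]
    simp only [smul_neg, sub_eq_add_neg]
  | ha P Q hP hQ => simp only [map_add, LinearMap.add_apply, hP, hQ]

lemma interiorBi_evalForm_ιMulti (P : ⋀[C]^2 S) (a b c : Module.Dual C S) (z : S) :
    interiorBi P (evalForm (exteriorPower.ιMulti C 3 ![a, b, c])) ![z] =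
      - (a z * c (sharp P b) + b z * a (sharp P c) + c z * b (sharp P a)) := by
  induction P using bivector_induction with
  | h0 => simp
  | hw x y =>
    rw [interiorBi_wedge, interior_apply, interior_apply, evalForm_ιMulti_three]
    simp only [sharp_wedge, map_sub, map_smul, smul_eq_mul]
    ring
  | ha P Q hP hQ =>
    simp only [map_add, LinearMap.add_apply, AlternatingMap.add_apply, hP, hQ]; ring

variable [Algebra ℝ C]

/-- Each `π^♯b ∧ π^♯c` arises twice, with a minus sign, from the derivation action; the constant
`-1/2` in `wedgeTwoSharp` compensates. -/
lemma psiTwo_ιMulti (π : ⋀[C]^2 S) (a b c : Module.Dual C S) (z : S) :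
    psiTwo π (exteriorPower.ιMulti C 3 ![a, b, c]) z =
      a z • wedgeVec (sharp π b) (sharp π c) + b z • wedgeVec (sharp π c) (sharp π a)
        + c z • wedgeVec (sharp π a) (sharp π b) := by
  have h : sharp π ∘ₗ flat ((evalForm (exteriorPower.ιMulti C 3 ![a, b, c])).curryLeft z) =
      a z • (b.smulRight (sharp π c) - c.smulRight (sharp π b))
      + b z • (c.smulRight (sharp π a) - a.smulRight (sharp π c))
      + c z • (a.smulRight (sharp π b) - b.smulRight (sharp π a)) := by
    have h1 : ∀ x, flat ((evalForm (exteriorPower.ιMulti C 3 ![a, b, c])).curryLeft z) x =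
        a z • (b x • c - c x • b) + b z • (c x • a - a x • c) + c z • (a x • b - b x • a) := by
      intro x
      ext y
      rw [flat_apply]
      change evalForm (exteriorPower.ιMulti C 3 ![a, b, c]) ![z, x, y] = _
      rw [evalForm_ιMulti_three]
      simp only [LinearMap.add_apply, LinearMap.sub_apply, LinearMap.smul_apply, smul_eq_mul]
      ring
    ext x
    simp only [LinearMap.comp_apply, h1, map_add, map_sub, map_smul, LinearMap.add_apply,
      LinearMap.sub_apply, LinearMap.smul_apply, LinearMap.smulRight_apply]
  have h2 : psiTwo π (exteriorPower.ιMulti C 3 ![a, b, c]) z = algebraMap ℝ C (-(1 / 2)) •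
      bivectorDer (sharp π ∘ₗ flat ((evalForm (exteriorPower.ιMulti C 3 ![a, b, c])).curryLeft z))
        π := rfl
  have h3 : algebraMap ℝ C (-(1 / 2)) * 2 = -1 := by
    rw [← map_ofNat (algebraMap ℝ C), ← map_mul]; norm_num
  rw [h2, h]
  simp only [map_add, map_sub, map_smul, LinearMap.add_apply, LinearMap.sub_apply,
    LinearMap.smul_apply, bivectorDer_smulRight]
  rw [wedgeVec_swap (sharp π c) (sharp π b), wedgeVec_swap (sharp π a) (sharp π c),
    wedgeVec_swap (sharp π b) (sharp π a)]
  have h4 : ∀ (f : C) (P : ⋀[C]^2 S), algebraMap ℝ C (-(1 / 2)) • f • (-P - P) = f • P := by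
    intro f P
    rw [← neg_one_smul C P, sub_eq_add_neg, ← neg_one_smul C P, ← add_smul, smul_smul, smul_smul]
    congr 1
    linear_combination (-f) * h3
  rw [smul_add, smul_add, h4, h4, h4]

/-- `- α ∧ ∂̲_{π,ψ} μ = 2 ⟨α, Y_{π,ψ}⟩ μ` for forms `μ` of top degree. -/
lemma HasLocalFrames.wedge_partialUnder (hS : HasLocalFrames C S (q + 2)) (π : ⋀[C]^2 S)
    (ψ : ⋀[C]^3 (Module.Dual C S)) (α : Module.Dual C S) (μ : Form C S (q + 2)) :
    wedge α (show Form C S (q + 1) from partialUnder π ψ μ) = - (2 * α (sectionY π ψ)) • μ := by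
  -- Both sides are linear in `ψ`, so it suffices to take `ψ = a ∧ b ∧ c`.
  let f : ⋀[C]^3 (Module.Dual C S) →ₗ[C] Form C S (q + 2) :=
    { toFun := fun ψ => wedge α (show Form C S (q + 1) from partialUnder π ψ μ)
      map_add' := by
        intro ψ ψ'
        rw [← wedge_add]
        congr 1
        ext v
        simp only [partialUnder, psiTwo, AlternatingMap.alternatizeUncurryFin_apply, map_add]
        rw [AlternatingMap.add_apply]
        simp only [AlternatingMap.alternatizeUncurryFin_apply, ← Finset.sum_add_distrib]
        refine Finset.sum_congr rfl fun i _ => ?_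
        rw [← smul_add]
        simp [AlternatingMap.curryLeft_add]
      map_smul' := by
        intro g ψ
        rw [RingHom.id_apply, ← wedge_smul]
        congr 1
        ext v
        rw [AlternatingMap.smul_apply]
        simp only [partialUnder, psiTwo, AlternatingMap.alternatizeUncurryFin_apply, map_smul,
          Finset.smul_sum]
        refine Finset.sum_congr rfl fun i _ => ?_
        rw [smul_comm g]
        simp [AlternatingMap.curryLeft_smul] }
  let g : ⋀[C]^3 (Module.Dual C S) →ₗ[C] Form C S (q + 2) :=
    { toFun := fun ψ => - (2 * α (sectionY π ψ)) • μ
      map_add' := by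
        intros; simp only [sectionY, contractPsi, map_add, neg_add, mul_add, add_smul]
      map_smul' := by
        intros
        simp only [sectionY, contractPsi, map_smul, RingHom.id_apply, smul_smul, ← smul_neg,
          smul_eq_mul]
        congr 1; ring }
  have hfg : f = g := by
    refine trivector_ext fun a b c => ?_
    change wedge α (show Form C S (q + 1) from
      partialUnder π (exteriorPower.ιMulti C 3 ![a, b, c]) μ) =
        - (2 * α (sectionY π (exteriorPower.ιMulti C 3 ![a, b, c]))) • μ
    have h1 : (show Form C S (q + 1) from partialUnder π (exteriorPower.ιMulti C 3 ![a, b, c]) μ)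
        = wedge a (interiorBi (wedgeVec (sharp π b) (sharp π c)) μ)
        + wedge b (interiorBi (wedgeVec (sharp π c) (sharp π a)) μ)
        + wedge c (interiorBi (wedgeVec (sharp π a) (sharp π b)) μ) := by
      ext v
      simp only [partialUnder, wedge, AlternatingMap.add_apply,
        AlternatingMap.alternatizeUncurryFin_apply, ← Finset.sum_add_distrib]
      refine Finset.sum_congr rfl fun i _ => ?_
      rw [← smul_add, ← smul_add]
      simp only [LinearMap.comp_apply, psiTwo_ιMulti, map_add, map_smul, LinearMap.flip_apply,
        LinearMap.smulRight_apply, AlternatingMap.add_apply]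
    rw [h1, wedge_add, wedge_add, hS.wedge_wedge_interiorBi, hS.wedge_wedge_interiorBi,
      hS.wedge_wedge_interiorBi, ← add_smul, ← add_smul]
    congr 1
    have hY : ∀ ψ, α (sectionY π ψ) = interiorBi π (evalForm ψ) ![sharp π α] := by
      intro ψ
      rw [sectionY, dual_sharp_swap, contractPsi, LinearMap.neg_apply, oneForm_symm_apply, neg_neg]
    -- The left side has six products, equal in pairs by skewness of `π`; this is the origin of the
    -- factor 2.
    rw [hY, interiorBi_evalForm_ιMulti, dual_sharp_swap π α a, dual_sharp_swap π α b,
      dual_sharp_swap π α c, dual_sharp_swap π b c, dual_sharp_swap π c a, dual_sharp_swap π a b]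
    ring
  exact congrArg (fun F => F ψ) hfg

namespace LieAlgebroid
variable (E : LieAlgebroid C S)

lemma lieDer_add_left (x y : S) {q : ℕ} (η : Form C S q) :
    E.lieDer (x + y) η = E.lieDer x η + E.lieDer y η := by
  cases q with
  | zero => simp only [lieDer, interiorVec_add_left]
  | succ q => simp only [lieDer, interiorVec_add_left, d_add]; abel

lemma lieDer_zero_left {q : ℕ} (η : Form C S q) : E.lieDer (0 : S) η = 0 := by
  simpa using E.lieDer_add_left 0 0 η

/-- In general the correction term is `d_A f ∧ i_x μ`; in top degree it is the scalar multiple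
`(ρ(x) f) μ`. -/
lemma lieDer_smul_left (hS : HasLocalFrames C S (q + 1)) (f : C) (x : S) (μ : Form C S (q + 1)) :
    E.lieDer (f • x) μ = f • E.lieDer x μ + E.anchor x f • μ := by
  rw [lieDer, lieDer, hS.form_eq_zero (Nat.lt_succ_self _) (E.d μ), map_zero, map_zero, zero_add,
    zero_add, interiorVec_smul_left, d_smul, hS.wedge_interiorVec, dFun_apply]

/-- When `d_A μ = 0`, Cartan's formula gives `d_A i_x i_y μ = L_x i_y μ - i_x L_y μ`. Commuting
`L_x` past `i_y` leaves only interior products of top forms, to which `wedge_interiorVec` applies.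
-/
lemma partialPi_wedge {μ : Form C S (q + 1)} (hμ : E.d μ = 0) (x y : S) :
    (show Form C S q from E.partialPi (wedgeVec x y) μ) = interiorVec (E.bracket x y) μ
      + interiorVec y (E.lieDer x μ) - interiorVec x (E.lieDer y μ) := by
  have h1 : interiorVec (E.bracket x y) μ + interiorVec y (E.lieDer x μ) =
      E.lieDer x (interiorVec y μ) := by rw [lieDer_interiorVec]; abel
  have h2 : E.lieDer y μ = E.d (interiorVec y μ) := by rw [lieDer, hμ, map_zero, zero_add]
  rw [h1, h2]
  cases q with
  | zero =>
    change - interiorBi (wedgeVec x y) (E.d μ) = _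
    rw [hμ, map_zero, neg_zero, lieDer, sub_self]
  | succ q =>
    change E.d (interiorBi (wedgeVec x y) μ) - interiorBi (wedgeVec x y) (E.d μ) = _
    rw [hμ, map_zero, sub_zero, interiorBi_wedge, lieDer]; abel

lemma partialPi_add (P Q : ⋀[C]^2 S) (μ : Form C S (q + 1)) :
    (show Form C S q from E.partialPi (P + Q) μ) =
      (show Form C S q from E.partialPi P μ) + (show Form C S q from E.partialPi Q μ) := by
  cases q with
  | zero =>
    change - interiorBi (P + Q) (E.d μ) = - interiorBi P (E.d μ) + - interiorBi Q (E.d μ)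
    rw [map_add, LinearMap.add_apply, neg_add]
  | succ q =>
    change E.d (interiorBi (P + Q) μ) - interiorBi (P + Q) (E.d μ) =
      (E.d (interiorBi P μ) - interiorBi P (E.d μ)) + (E.d (interiorBi Q μ) - interiorBi Q (E.d μ))
    simp only [map_add, LinearMap.add_apply, d_add]
    abel

lemma partialPi_zero (μ : Form C S (q + 1)) :
    (show Form C S q from E.partialPi 0 μ) = 0 := by
  simpa using E.partialPi_add 0 0 μ

lemma interiorPiD_wedge (x y : S) (α : Module.Dual C S) :
    E.interiorPiD (wedgeVec x y) α = E.anchor y (α x) - E.anchor x (α y) + α (E.bracket x y) := by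
  rw [interiorPiD, interiorBi_wedge, interior_apply, interior_apply, d_apply, koszul_cons_zero,
    E.bracket_neg_swap x y]
  simp [oneForm_apply, sub_eq_add_neg]

/-- `- α ∧ ∂_π μ = L_{π^♯ α} μ - (i_π d_A α) μ` for forms `μ` of top degree. -/
lemma wedge_partialPi (hS : HasLocalFrames C S (q + 1)) (π : ⋀[C]^2 S)
    (α : Module.Dual C S) (μ : Form C S (q + 1)) :
    - wedge α (show Form C S q from E.partialPi π μ) =
      E.lieDer (sharp π α) μ - E.interiorPiD π α • μ := by
  induction π using bivector_induction with
  | h0 =>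
    rw [partialPi_zero, wedge_zero, map_zero, LinearMap.zero_apply, lieDer_zero_left, interiorPiD]
    simp
  | hw x y =>
    -- The derivatives of `α x` and `α y` in `L_{π^♯α} μ` cancel those in `i_π d_A α`, leaving
    -- `α([x, y])` and two Lie derivatives of `μ`.
    rw [E.partialPi_wedge (hS.form_eq_zero (Nat.lt_succ_self _) (E.d μ)), wedge_sub, wedge_add,
      hS.wedge_interiorVec, hS.wedge_interiorVec, hS.wedge_interiorVec, sharp_wedge,
      sub_eq_add_neg (α x • y), ← neg_smul, lieDer_add_left, E.lieDer_smul_left hS,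
      E.lieDer_smul_left hS, interiorPiD_wedge, map_neg]
    module
  | ha P Q hP hQ =>
    rw [partialPi_add, wedge_add, neg_add, hP, hQ, map_add, LinearMap.add_apply, lieDer_add_left]
    have : E.interiorPiD (P + Q) α = E.interiorPiD P α + E.interiorPiD Q α := by
      simp only [interiorPiD, map_add, LinearMap.add_apply, AlternatingMap.add_apply]
    rw [this]; module

/-- The operators `D^∂` on forms of top degree in terms of Lie derivations. -/
lemma generatorRep_eq {N : ℕ} (hS : HasLocalFrames C S N) (π : ⋀[C]^2 S)
    (ψ : ⋀[C]^3 (Module.Dual C S)) (α : Module.Dual C S) (μ : Form C S N) :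
    E.generatorRep π ψ α μ = E.lieDer (sharp π α) μ + E.modularFun π ψ α • μ := by
  rcases N with _ | _ | q
  -- In rank 0 there are no nonzero 1-forms, in agreement with the value 0 of `generatorRep`.
  · have h0 : α = 0 := by
      refine oneForm.injective ?_
      rw [hS.form_eq_zero Nat.zero_lt_one (oneForm α), map_zero]
    subst h0
    rw [map_zero, lieDer_zero_left, modularFun_eq]
    simp [generatorRep, interiorPiD, d_zero]
  -- In rank 1 a 3-form vanishes, so `Y = 0`, which matches the value 0 of `partialUnder` in degree
  -- one.
  · have hY : sectionY π ψ = 0 := by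
      rw [sectionY, contractPsi, hS.form_eq_zero (by norm_num) (evalForm ψ)]; simp
    rw [modularFun_eq, hY]
    change - wedge α ((show Form C S 0 from E.partialPi π μ) + 0 +
      interiorVec (sectionY π ψ) μ) = _
    rw [add_zero, hY, interiorVec_zero_left, add_zero, E.wedge_partialPi hS, map_zero]
    module
  -- The interior product by `ψ^{(2)}` contributes `2⟨α, Y⟩` and `i_Y` contributes `-⟨α, Y⟩`.
  · rw [modularFun_eq]
    change - wedge α ((show Form C S (q + 1) from E.partialPi π μ) +
      (show Form C S (q + 1) from partialUnder π ψ μ) + interiorVec (sectionY π ψ) μ) = _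
    rw [wedge_add, wedge_add, hS.wedge_partialUnder, hS.wedge_interiorVec, neg_add, neg_add,
      E.wedge_partialPi hS]
    module

variable {E} {π : ⋀[C]^2 S} {ψ : ⋀[C]^3 (Module.Dual C S)} {N : ℕ}

lemma generatorRep_smul_left (f : C) (α : Module.Dual C S) (μ : Form C S N) :
    E.generatorRep π ψ (f • α) μ = f • E.generatorRep π ψ α μ := by
  cases N with
  | zero => simp [generatorRep]
  | succ q =>
    change - wedge (f • α) (show Form C S q from E.generator π ψ μ) =
      f • - wedge α (show Form C S q from E.generator π ψ μ)
    rw [wedge_smul_left, smul_neg]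

lemma generatorRep_add_left (α β : Module.Dual C S) (μ : Form C S N) :
    E.generatorRep π ψ (α + β) μ = E.generatorRep π ψ α μ + E.generatorRep π ψ β μ := by
  cases N with
  | zero => simp [generatorRep]
  | succ q =>
    change - wedge (α + β) (show Form C S q from E.generator π ψ μ) =
      - wedge α (show Form C S q from E.generator π ψ μ) +
      - wedge β (show Form C S q from E.generator π ψ μ)
    rw [wedge_add_left, neg_add]

variable (E) in
/-- The representation `D^∂` of the Lie algebroid `A^*` on `∧^N A^*`. -/
noncomputable def generatorRepresentation (hE : E.IsTwistedPoisson π ψ)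
    (hS : HasLocalFrames C S N) : Representation (E.dualAlgebroid hE hS) (Form C S N) where
  D := AddMonoidHom.mk'
    (fun α => AddMonoidHom.mk' (E.generatorRep π ψ α) (fun μ ν => by
      simp only [E.generatorRep_eq hS, lieDer_add, smul_add]; abel))
    (fun α β => by ext1 μ; exact generatorRep_add_left α β μ)
  smul_left f α μ := generatorRep_smul_left f α μ
  leibniz α f μ := by
    change E.generatorRep π ψ α (f • μ) = f • E.generatorRep π ψ α μ + E.anchor (sharp π α) f • μ
    rw [E.generatorRep_eq hS, E.generatorRep_eq hS, lieDer_smul]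
    module
  flat α β μ := by
    change E.generatorRep π ψ (E.dualBracket π ψ α β) μ =
      E.generatorRep π ψ α (E.generatorRep π ψ β μ) - E.generatorRep π ψ β (E.generatorRep π ψ α μ)
    -- The curvature splits into that of `L_{π^♯α}`, zero because `π^♯` preserves brackets, and the
    -- coboundary of `modularFun`, zero by the cocycle identity.
    simp only [E.generatorRep_eq hS, hE.sharp_dualBracket hS, hE.modularFun_dualBracket hS,
      lieDer_bracket, lieDer_add, lieDer_smul]
    module

end LieAlgebroid
end TopForms
end TwistedPoisson

namespace TwistedPoisson

/-! ### Characteristic classes of representations on line bundles. -/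

section CharacteristicClass
variable {C S L : Type*} [CommRing C] [Algebra ℝ C] [AddCommGroup S] [Module C S]
  [AddCommGroup L] [Module C L]

lemma squareOp_tmul (D : L →+ L) (X : Derivation ℝ C C)
    (h : ∀ (f : C) (m : L), D (f • m) = f • D m + X f • m) (m n : L) :
    squareOp D X h (m ⊗ₜ n) = D m ⊗ₜ n + m ⊗ₜ D n := rfl

lemma squareOp_smul (D : L →+ L) (X : Derivation ℝ C C)
    (h : ∀ (f : C) (m : L), D (f • m) = f • D m + X f • m) (f : C) (t : L ⊗[C] L) :
    squareOp D X h (f • t) = f • squareOp D X h t + X f • t := by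
  induction t using TensorProduct.induction_on with
  | zero => simp
  | tmul m n =>
    rw [TensorProduct.smul_tmul', squareOp_tmul, squareOp_tmul, h, TensorProduct.add_tmul,
      smul_add]
    simp only [TensorProduct.smul_tmul']
    abel
  | add s t hs ht => simp only [smul_add, map_add, hs, ht]; abel

namespace Representation
variable {E : LieAlgebroid C S} (R : Representation E L)

/-- The representation on `L ⊗ L` induced by a representation on `L`. -/
noncomputable def square : Representation E (L ⊗[C] L) where
  D := AddMonoidHom.mk' (fun x => squareOp (R.D x) (E.anchor x) (R.leibniz x)) (fun x y => by
    ext t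
    induction t using TensorProduct.induction_on with
    | zero => simp
    | tmul m n =>
      simp only [AddMonoidHom.add_apply, squareOp_tmul, map_add, TensorProduct.add_tmul,
        TensorProduct.tmul_add]
      abel
    | add s t hs ht =>
      refine (map_add (squareOp (R.D (x + y)) (E.anchor (x + y)) (R.leibniz (x + y))) s t).trans ?_
      rw [hs, ht, map_add])
  smul_left f x t := by
    simp only [AddMonoidHom.mk'_apply]
    induction t using TensorProduct.induction_on with
    | zero => simp
    | tmul m n =>
      simp only [squareOp_tmul, R.smul_left, smul_add, TensorProduct.smul_tmul',
        TensorProduct.tmul_smul]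
    | add s t hs ht =>
      refine (map_add (squareOp (R.D (f • x)) (E.anchor (f • x)) (R.leibniz (f • x))) s t).trans ?_
      rw [hs, ht, map_add, smul_add]
  leibniz x f t := squareOp_smul (R.D x) (E.anchor x) (R.leibniz x) f t
  flat x y t := by
    simp only [AddMonoidHom.mk'_apply]
    induction t using TensorProduct.induction_on with
    | zero => simp
    | tmul m n =>
      simp only [squareOp_tmul, map_add, R.flat, TensorProduct.sub_tmul, TensorProduct.tmul_sub]
      abel
    | add s t hs ht =>
      refine (map_add (squareOp (R.D (E.bracket x y)) (E.anchor (E.bracket x y))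
        (R.leibniz (E.bracket x y))) s t).trans ?_
      rw [hs, ht]; simp only [map_add]; abel

lemma square_tmul (x : S) (m n : L) :
    R.square.D x (m ⊗ₜ n) = R.D x m ⊗ₜ n + m ⊗ₜ R.D x n := rfl

/-- The cocycle of a representation on a line bundle with a nowhere vanishing section. -/
lemma exists_cocycle {s : L} (hs : IsFrame C s) :
    ∃ θ : E.cocycles, ∀ x, R.D x s = (θ : Module.Dual C S) x • s := by
  choose θ hθ using fun x => hs.2 (R.D x s)
  simp only at hθ
  have inj : ∀ {f g : C}, f • s = g • s → f = g := fun h => hs.1 h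
  let θ' : Module.Dual C S :=
    { toFun := θ
      map_add' := fun x y => inj (by
        rw [hθ, add_smul, hθ, hθ, map_add, AddMonoidHom.add_apply])
      map_smul' := fun f x => inj (by
        rw [hθ, smul_eq_mul, RingHom.id_apply, mul_smul, hθ, R.smul_left]) }
  refine ⟨⟨θ', fun x y => ?_⟩, fun x => (hθ x).symm⟩
  -- Flatness on the frame gives closedness, since the products of values of `θ` cancel by
  -- commutativity.
  have h := R.flat x y s
  rw [← hθ, ← hθ x, ← hθ y, R.leibniz, R.leibniz, ← hθ x, ← hθ y] at h
  have h2 : θ (E.bracket x y) = E.anchor x (θ y) - E.anchor y (θ x) := inj (by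
    rw [h, sub_smul, smul_smul, smul_smul, mul_comm]; abel)
  change E.anchor x (θ y) - E.anchor y (θ x) - θ (E.bracket x y) = 0
  rw [h2, sub_self]

/-- Two nowhere vanishing sections define the same class, provided that invertible functions have
logarithmic primitives. -/
lemma classOf_eq (hlog : ∀ f : C, IsUnit f → ∃ g : C, ∀ D : Derivation ℝ C C, D f = f * D g)
    {s s' : L} (hs : IsFrame C s) (hs' : IsFrame C s') {θ θ' : E.cocycles}
    (hθ : ∀ x, R.D x s = (θ : Module.Dual C S) x • s)
    (hθ' : ∀ x, R.D x s' = (θ' : Module.Dual C S) x • s') : E.classOf θ = E.classOf θ' := by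
  obtain ⟨f, rfl⟩ := hs.2 s'
  simp only at hs' hθ'
  obtain ⟨f', hf'⟩ := hs'.2 s
  simp only at hf'
  have hu : f' * f = 1 := hs.1 (by simp only; rw [mul_smul, hf', one_smul])
  -- For `s' = f s` the cocycles differ by `df / f`, which is `dg` for a logarithmic primitive `g`.
  obtain ⟨g, hg⟩ := hlog f (IsUnit.of_mul_eq_one f' (by rw [mul_comm]; exact hu))
  symm
  refine (Submodule.Quotient.eq _).2 ⟨g, ?_⟩
  ext x
  have h := hθ' x
  rw [R.leibniz, hθ, smul_smul, ← add_smul, smul_smul] at h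
  have h2 := hs.1 h
  rw [hg] at h2
  change (θ' : Module.Dual C S) x - (θ : Module.Dual C S) x = E.anchor x g
  linear_combination (-f') * h2 + ((θ : Module.Dual C S) x + E.anchor x g -
    (θ' : Module.Dual C S) x) * hu

omit [Algebra ℝ C] in
lemma _root_.TwistedPoisson.IsFrame.tmul {s : L} (hs : IsFrame C s) :
    IsFrame C (s ⊗ₜ[C] s) := by
  let e : C ≃ₗ[C] L := LinearEquiv.ofBijective (LinearMap.toSpanSingleton C L s) hs
  let e2 : C ≃ₗ[C] L ⊗[C] L := (TensorProduct.lid C C).symm.trans (TensorProduct.congr e e)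
  have h : ∀ f : C, e2 f = f • (s ⊗ₜ[C] s) := by
    intro f
    change ((1 : C) • s) ⊗ₜ[C] (f • s) = _
    rw [one_smul, TensorProduct.tmul_smul]
  have h2 : (fun f : C => f • (s ⊗ₜ[C] s)) = e2 := by ext1 f; exact (h f).symm
  rw [IsFrame, h2]
  exact e2.bijective

/-- The class is half of that of `L ⊗ L`. This is consistent with a frame `s` of `L`, because the
cocycle of `s ⊗ s` is twice that of `s`. -/
lemma exists_isCharacteristicClass
    (hlog : ∀ f : C, IsUnit f → ∃ g : C, ∀ D : Derivation ℝ C C, D f = f * D g) :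
    ∃ c, R.IsCharacteristicClass c := by
  by_cases hσ : ∃ σ : L ⊗[C] L, IsFrame C σ
  · obtain ⟨σ, hσ⟩ := hσ
    obtain ⟨θ, hθ⟩ := R.square.exists_cocycle hσ
    refine ⟨(1 / 2 : ℝ) • E.classOf θ, fun s hs => ?_, fun σ' hσ' => ?_⟩
    · obtain ⟨η, hη⟩ := R.exists_cocycle hs
      refine ⟨η, hη, ?_⟩
      have h : ∀ x, R.square.D x (s ⊗ₜ s) =
          (((2 : ℝ) • η : E.cocycles) : Module.Dual C S) x • (s ⊗ₜ[C] s) := by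
        intro x
        rw [square_tmul, hη, ← TensorProduct.smul_tmul', TensorProduct.tmul_smul, ← add_smul]
        congr 1
        change _ = (2 : ℝ) • (η : Module.Dual C S) x
        rw [two_smul]
      rw [R.square.classOf_eq hlog hσ hs.tmul hθ h]
      change (1 / 2 : ℝ) • E.classOf ((2 : ℝ) • η) = _
      rw [LieAlgebroid.classOf, Submodule.Quotient.mk_smul, smul_smul]
      norm_num
    · obtain ⟨η, hη⟩ := R.square.exists_cocycle hσ'
      exact ⟨η, hη, by rw [R.square.classOf_eq hlog hσ hσ' hθ hη]⟩
  -- If `L ⊗ L` has no frame then neither has `L`, and both conditions are vacuous.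
  · exact ⟨0, fun s hs => (hσ ⟨_, hs.tmul⟩).elim, fun σ' hσ' => (hσ ⟨_, hσ'⟩).elim⟩

end Representation
end CharacteristicClass
end TwistedPoisson

namespace TwistedPoisson

/-! ### Logarithms of invertible smooth functions, for abstract derivations. -/

section LogarithmicPrimitive

/-- The second order remainder of the exponential function is smooth. -/
lemma exists_contDiff_exp_eq :
    ∃ k : ℝ → ℝ, ContDiff ℝ ∞ k ∧ ∀ t, Real.exp t = 1 + t + t ^ 2 * k t := by
  -- Removable singularities: the divided difference of an entire function is entire. Two divided
  -- differences of `exp`, restricted to the real line, give the remainder.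
  have hd : ∀ f : ℂ → ℂ, Differentiable ℂ f → Differentiable ℂ (dslope f 0) := fun f hf =>
    differentiableOn_univ.1
      ((Complex.differentiableOn_dslope Filter.univ_mem).2 hf.differentiableOn)
  have h2 := hd _ (hd _ Complex.differentiable_exp)
  refine ⟨fun t => (dslope (dslope Complex.exp 0) 0 (t : ℂ)).re, h2.contDiff.real_of_complex,
    fun t => ?_⟩
  have e1 := sub_smul_dslope Complex.exp 0 (t : ℂ)
  have e2 := sub_smul_dslope (dslope Complex.exp 0) 0 (t : ℂ)
  rw [dslope_same, Complex.deriv_exp, Complex.exp_zero, sub_zero, smul_eq_mul] at e2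
  rw [Complex.exp_zero, sub_zero, smul_eq_mul] at e1
  have e3 : Complex.exp t = 1 + t + ((t ^ 2 : ℝ) : ℂ) * dslope (dslope Complex.exp 0) 0 t := by
    push_cast
    linear_combination -e1 - (t : ℂ) * e2
  have e4 := congrArg Complex.re e3
  rw [Complex.exp_ofReal_re, Complex.add_re, Complex.add_re, Complex.re_ofReal_mul,
    Complex.one_re, Complex.ofReal_re] at e4
  exact e4

variable {V : Type*} [NormedAddCommGroup V] [NormedSpace ℝ V]
  {M : Type*} [TopologicalSpace M] [ChartedSpace V M]

/-- The composition of a smooth function on the line with a function on `M`. -/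
noncomputable def smoothComp (φ : ℝ → ℝ) (hφ : ContDiff ℝ ∞ φ) (g : C^∞⟮𝓘(ℝ, V), M; ℝ⟯) :
    C^∞⟮𝓘(ℝ, V), M; ℝ⟯ :=
  ⟨fun x => φ (g x), hφ.contMDiff.comp g.contMDiff⟩

/-- The derivation is only algebraic, so the chain rule is obtained from Taylor's formula: with `u =
g - g(p)`, the second-order remainder is a multiple of `u²`, and its derivative vanishes at `p`. -/
lemma derivation_exp (D : Derivation ℝ C^∞⟮𝓘(ℝ, V), M; ℝ⟯ C^∞⟮𝓘(ℝ, V), M; ℝ⟯)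
    (g : C^∞⟮𝓘(ℝ, V), M; ℝ⟯) :
    D (smoothComp Real.exp Real.contDiff_exp g) =
      smoothComp Real.exp Real.contDiff_exp g * D g := by
  obtain ⟨k, hk, hexp⟩ := exists_contDiff_exp_eq
  ext p
  let c : C^∞⟮𝓘(ℝ, V), M; ℝ⟯ := algebraMap ℝ _ (g p)
  let c' : C^∞⟮𝓘(ℝ, V), M; ℝ⟯ := algebraMap ℝ _ (Real.exp (g p))
  let u := g - c
  have hu : u p = 0 := sub_self (g p)
  have h1 : smoothComp Real.exp Real.contDiff_exp g = c' * (1 + u + u * u * smoothComp k hk u) := by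
    ext x
    change Real.exp (g x) = Real.exp (g p) *
      (1 + (g x - g p) + (g x - g p) * (g x - g p) * k (g x - g p))
    rw [← pow_two, ← hexp, ← Real.exp_add]; congr 1; ring
  have hc : D c = 0 := D.map_algebraMap _
  have hc' : D c' = 0 := D.map_algebraMap _
  have h2 : D (smoothComp Real.exp Real.contDiff_exp g) =
      c' * (D g + u * (2 * smoothComp k hk u * D g + u * D (smoothComp k hk u))) := by
    rw [h1]
    simp only [Derivation.leibniz, hc', map_add, Derivation.map_one_eq_zero, u, map_sub, hc, smul_eq_mul]
    ring
  rw [h2]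
  change Real.exp (g p) * (D g p + u p * _) = Real.exp (g p) * D g p
  rw [hu]; ring

/-- An invertible function `f` has the logarithmic primitive `log |f|`, for all derivations. -/
lemma exists_logarithmic_primitive (f : C^∞⟮𝓘(ℝ, V), M; ℝ⟯) (hf : IsUnit f) :
    ∃ g : C^∞⟮𝓘(ℝ, V), M; ℝ⟯,
      ∀ D : Derivation ℝ C^∞⟮𝓘(ℝ, V), M; ℝ⟯ C^∞⟮𝓘(ℝ, V), M; ℝ⟯, D f = f * D g := by
  obtain ⟨f', hf'⟩ := hf.exists_right_inv
  have h0 : ∀ x, f x ≠ 0 := fun x h => by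
    have : f x * f' x = 1 := congrArg (fun F : C^∞⟮𝓘(ℝ, V), M; ℝ⟯ => F x) hf'
    rw [h, zero_mul] at this
    exact zero_ne_one this
  -- `Real.log` is `log |·|`, so no sign condition on `f` is needed.
  let g : C^∞⟮𝓘(ℝ, V), M; ℝ⟯ := ⟨fun x => Real.log (f x), fun x =>
    ((Real.contDiffAt_log (n := ∞)).2 (h0 x)).contMDiffAt.comp x f.contMDiff.contMDiffAt⟩
  refine ⟨g, fun D => ?_⟩
  let h := smoothComp Real.exp Real.contDiff_exp g
  -- `e` is the sign of `f`. From `e² = 1` follows `D e = 0`, with no appeal to connected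
  -- components.
  let e : C^∞⟮𝓘(ℝ, V), M; ℝ⟯ := f * smoothComp Real.exp Real.contDiff_exp (-g)
  have hh : ∀ x, h x = |f x| := fun x => Real.exp_log_eq_abs (h0 x)
  have he : ∀ x, e x = f x * |f x|⁻¹ := fun x => by
    change f x * Real.exp (- Real.log (f x)) = _
    rw [Real.exp_neg, Real.exp_log_eq_abs (h0 x)]
  have hee : e * e = 1 := by
    ext x
    change e x * e x = 1
    have := abs_pos.2 (h0 x)
    rw [he, mul_mul_mul_comm, ← mul_inv, abs_mul_abs_self]
    exact mul_inv_cancel₀ (mul_self_ne_zero.2 (h0 x))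
  have hfe : f = e * h := by
    ext x
    change f x = e x * h x
    rw [he, hh, mul_assoc, inv_mul_cancel₀ (abs_pos.2 (h0 x)).ne', mul_one]
  have hDe : D e = 0 := by
    have h3 : 2 * (e * D e) = 0 := by
      have := congrArg D hee
      rw [Derivation.leibniz, Derivation.map_one_eq_zero, smul_eq_mul] at this
      linear_combination this
    have h4 : e * D e = 0 := (isUnit_two _).mul_left_cancel (by rw [h3, mul_zero])
    linear_combination (- D e) * hee + e * h4
  have hDh : D h = h * D g := derivation_exp D g
  rw [hfe, Derivation.leibniz, hDe, hDh]
  simp only [smul_eq_mul]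
  ring

end LogarithmicPrimitive

/-! ### Global sections that form a frame near a point. -/

section LocalFrames
variable {V : Type*} [NormedAddCommGroup V] [NormedSpace ℝ V]
  {M : Type*} [TopologicalSpace M] [ChartedSpace V M]
  {F : Type*} [NormedAddCommGroup F] [NormedSpace ℝ F]
  {A : M → Type*} [TopologicalSpace (Bundle.TotalSpace F A)] [∀ x, TopologicalSpace (A x)]
  [∀ x, AddCommGroup (A x)] [∀ x, Module ℝ (A x)] [FiberBundle F A] [VectorBundle ℝ F A]

lemma section_sum_apply {ι : Type*} (T : Finset ι) (s : ι → Cₛ^∞⟮𝓘(ℝ, V); F, A⟯) (x : M) :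
    (∑ i ∈ T, s i) x = ∑ i ∈ T, s i x := by
  have := map_sum (ContMDiffSection.coeAddHom 𝓘(ℝ, V) F ∞ A) s T
  exact (congrFun this x).trans (Finset.sum_apply _ _ _)

lemma function_sum_apply {ι : Type*} (T : Finset ι) (f : ι → C^∞⟮𝓘(ℝ, V), M; ℝ⟯) (x : M) :
    (∑ i ∈ T, f i) x = ∑ i ∈ T, f i x :=
  map_sum (ContMDiffMap.evalRingHom x : C^∞⟮𝓘(ℝ, V), M; ℝ⟯ →+* ℝ) f T

/-- Global sections `e` of `A` and `ε` of `A^*`, which form dual frames at the point `p`, and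
dual frames up to a factor `χ` everywhere. -/
structure FrameNear (F : Type*) [NormedAddCommGroup F] [NormedSpace ℝ F]
    (A : M → Type*) [TopologicalSpace (Bundle.TotalSpace F A)] [∀ x, TopologicalSpace (A x)]
    [∀ x, AddCommGroup (A x)] [∀ x, Module ℝ (A x)] [FiberBundle F A] [VectorBundle ℝ F A]
    (p : M) (N : ℕ) where
  χ : C^∞⟮𝓘(ℝ, V), M; ℝ⟯
  e : Fin N → Cₛ^∞⟮𝓘(ℝ, V); F, A⟯
  ε : Fin N → Module.Dual C^∞⟮𝓘(ℝ, V), M; ℝ⟯ Cₛ^∞⟮𝓘(ℝ, V); F, A⟯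
  smul_eq : ∀ s, χ • s = ∑ i, ε i s • e i
  χ_apply : χ p = 1
  ε_apply : ∀ i j, ε i (e j) p = if i = j then 1 else 0

variable [FiniteDimensional ℝ V] [IsManifold 𝓘(ℝ, V) ∞ M] [T2Space M] [FiniteDimensional ℝ F]
  [ContMDiffVectorBundle ∞ F A 𝓘(ℝ, V)]

/-- A local frame and its dual frame are both multiplied by a bump function `f` and extended by
zero; hence the factor `χ = f²`. -/
lemma nonempty_frameNear (p : M) :
    Nonempty (FrameNear (V := V) F A p (Module.finrank ℝ F)) := by
  have : ContMDiffVectorBundle 1 F A 𝓘(ℝ, V) := ContMDiffVectorBundle.of_le (n := ∞) (by simp)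
  let t := trivializationAt F A p
  let b := Module.finBasis ℝ F
  have hp : p ∈ t.baseSet := FiberBundle.mem_baseSet_trivializationAt' p
  obtain ⟨f, hf⟩ := (SmoothBumpFunction.nhds_basis_support (I := 𝓘(ℝ, V))
    (t.open_baseSet.mem_nhds hp)).ex_mem
  have hf0 : ∀ x, x ∉ t.baseSet → f x = 0 := fun x hx =>
    image_eq_zero_of_notMem_tsupport fun h => hx (hf h)
  let e : Fin (Module.finrank ℝ F) → Cₛ^∞⟮𝓘(ℝ, V); F, A⟯ := fun i =>
    ⟨fun x => f x • t.localFrame b i x, ContMDiffOn.smul_section_of_tsupport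
      f.contMDiff.contMDiffOn t.open_baseSet hf (t.contMDiffOn_localFrame_baseSet ∞ b i)⟩
  let ε : Fin (Module.finrank ℝ F) → Module.Dual C^∞⟮𝓘(ℝ, V), M; ℝ⟯ Cₛ^∞⟮𝓘(ℝ, V); F, A⟯ := fun i =>
    { toFun := fun s => ⟨fun x => f x * t.localFrameCoeff 𝓘(ℝ, V) b i x (s x),
        contMDiff_of_tsupport fun x hx => by
          have hx' : x ∈ t.baseSet := hf (tsupport_mul_subset_left hx)
          exact f.contMDiffAt.mul
            (contMDiffAt_localFrameCoeff b hx' (s.contMDiff x) i)⟩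
      map_add' := fun s s' => by
        ext x
        change f x * t.localFrameCoeff 𝓘(ℝ, V) b i x (s x + s' x) = f x * _ + f x * _
        rw [map_add, mul_add]
      map_smul' := fun g s => by
        ext x
        change f x * t.localFrameCoeff 𝓘(ℝ, V) b i x (g x • s x) = g x * (f x * _)
        rw [map_smul, smul_eq_mul]; ring }
  refine ⟨⟨⟨fun x => f x * f x, f.contMDiff.mul f.contMDiff⟩, e, ε, fun s => ?_, ?_, fun i j => ?_⟩⟩
  · ext x
    rw [section_sum_apply]
    change (f x * f x) • s x = ∑ i, (f x * t.localFrameCoeff 𝓘(ℝ, V) b i x (s x)) •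
      (f x • t.localFrame b i x)
    by_cases hx : x ∈ t.baseSet
    · conv_lhs => rw [Bundle.Trivialization.eq_sum_localFrameCoeff_smul (I := 𝓘(ℝ, V)) (e := t)
        (b := b) (s := fun x => s x) hx]
      rw [Finset.smul_sum]
      refine Finset.sum_congr rfl fun i _ => ?_
      rw [smul_smul, smul_smul]; congr 1; ring
    · simp [hf0 x hx]
  · change f p * f p = 1
    rw [f.eq_one, mul_one]
  · change f p * t.localFrameCoeff 𝓘(ℝ, V) b i p (f p • t.localFrame b j p) = _
    rw [f.eq_one, one_smul, one_mul, t.localFrameCoeff_apply_of_mem_baseSet b hp,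
      t.localFrame_apply_of_mem_baseSet b hp, Module.Basis.repr_self, Finsupp.single_apply]
    simp only [eq_comm]

end LocalFrames
end TwistedPoisson

namespace TwistedPoisson

/-! ### Modular sections as cocycles of `D^∂`. -/

section TopDegree
variable {C S : Type*} [CommRing C] [AddCommGroup S] [Module C S] {N : ℕ}

/-- A form of top degree in a local frame. -/
lemma form_apply_eq_det {χ : C} {e : Fin N → S} {ε : Fin N → Module.Dual C S}
    (h : ∀ s, χ • s = ∑ i, ε i s • e i) (η : Form C S N) (a : Fin N → S) :
    χ ^ N * η a = η e * (Matrix.of fun i j => ε i (a j)).det := by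
  have h2 := η.toMultilinearMap.map_smul_univ (fun _ => χ) a
  simp only [AlternatingMap.coe_multilinearMap, Finset.prod_const, Finset.card_univ,
    Fintype.card_fin, smul_eq_mul] at h2
  have h1 := congrArg (fun F => F (fun j i => ε i (a j)))
    ((η.compLinearMap (Fintype.linearCombination C e)).eq_smul_basis_det (Pi.basisFun C (Fin N)))
  simp only [AlternatingMap.compLinearMap_apply, Fintype.linearCombination_apply, ← h,
    AlternatingMap.smul_apply, smul_eq_mul] at h1
  rw [← h2, h1]
  congr 1
  · congr 1
    funext i
    rw [Pi.basisFun_apply]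
    simp [Pi.single_apply]

end TopDegree

/-- Used with `q` the Lie derivative of `t`, and with `z, y, p` the values `⟨α, Z⟩`, `⟨α, Y⟩`, `i_π
d_A α`, or their doubles for densities: it exchanges the equation defining `X = Z - Y` for the
equation of the cocycle of `D^∂`. -/
lemma sub_smul_eq_sub_iff {C T : Type*} [CommRing C] [AddCommGroup T] [Module C T]
    (q t : T) (z y p : C) :
    (z - y) • t = q - p • t ↔ q + (y - p) • t = z • t := by
  rw [sub_smul, sub_smul, ← sub_eq_zero, ← sub_eq_zero (a := q + _), ← neg_eq_zero]
  exact Eq.congr_left (by abel)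

section ModularSection
variable {C S : Type*} [CommRing C] [Algebra ℝ C] [AddCommGroup S] [Module C S] {N : ℕ}
  {E : LieAlgebroid C S} {π : ⋀[C]^2 S} {ψ : ⋀[C]^3 (Module.Dual C S)}

namespace LieAlgebroid

/-- Modular sections are given by the cocycle of the representation `D^∂`. -/
lemma isModularSection_iff (hE : E.IsTwistedPoisson π ψ) (hS : HasLocalFrames C S N)
    (μ : Form C S N) (Z : S) : E.IsModularSection π ψ μ Z ↔
      ∀ α, (E.generatorRepresentation hE hS).D α μ = α Z • μ := by
  have hR : ∀ α, (E.generatorRepresentation hE hS).D α μ =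
      E.lieDer (sharp π α) μ + (α (sectionY π ψ) - E.interiorPiD π α) • μ := fun α => by
    rw [← modularFun_eq]; exact E.generatorRep_eq hS π ψ α μ
  constructor
  · rintro ⟨X, hX, rfl⟩ α
    rw [hR, map_add, add_smul, hX]; module
  · intro h
    refine ⟨Z - sectionY π ψ, fun α => ?_, by abel⟩
    rw [map_sub]
    exact (sub_smul_eq_sub_iff _ _ _ _ _).2 ((hR α).symm.trans (h α))

lemma squareOp_generatorRepresentation (hE : E.IsTwistedPoisson π ψ)
    (hS : HasLocalFrames C S N) (α : Module.Dual C S) (σ : Form C S N ⊗[C] Form C S N) :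
    squareOp ((E.generatorRepresentation hE hS).D α) ((E.dualAlgebroid hE hS).anchor α)
        ((E.generatorRepresentation hE hS).leibniz α) σ =
      squareOp (E.lieDerHom (sharp π α) N) (E.anchor (sharp π α)) (E.lieDer_smul (sharp π α)) σ
        + (2 * E.modularFun π ψ α) • σ := by
  induction σ using TensorProduct.induction_on with
  | zero => simp
  | tmul m n =>
    change E.generatorRep π ψ α m ⊗ₜ n + m ⊗ₜ E.generatorRep π ψ α n =
      E.lieDer (sharp π α) m ⊗ₜ n + m ⊗ₜ E.lieDer (sharp π α) n + _
    rw [E.generatorRep_eq hS, E.generatorRep_eq hS, TensorProduct.add_tmul, TensorProduct.tmul_add,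
      TensorProduct.tmul_smul, ← TensorProduct.smul_tmul', two_mul, add_smul]
    abel
  | add s t hs ht =>
    refine (map_add (squareOp ((E.generatorRepresentation hE hS).D α)
      ((E.dualAlgebroid hE hS).anchor α) ((E.generatorRepresentation hE hS).leibniz α)) s t).trans ?_
    rw [hs, ht, smul_add]
    refine Eq.trans ?_ (congrArg (· + _) (map_add (squareOp (E.lieDerHom (sharp π α) N)
      (E.anchor (sharp π α)) (E.lieDer_smul (sharp π α))) s t).symm)
    abel

lemma isModularSectionDensity_iff (hE : E.IsTwistedPoisson π ψ) (hS : HasLocalFrames C S N)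
    (σ : Form C S N ⊗[C] Form C S N) (Z : S) : E.IsModularSectionDensity π ψ σ Z ↔
      ∀ α, squareOp ((E.generatorRepresentation hE hS).D α) ((E.dualAlgebroid hE hS).anchor α)
        ((E.generatorRepresentation hE hS).leibniz α) σ = (2 * α Z) • σ := by
  constructor
  · rintro ⟨X, hX, rfl⟩ α
    refine (squareOp_generatorRepresentation hE hS α σ).trans ?_
    have h1 := hX α
    rw [← add_sub_cancel_right X (sectionY π ψ), map_sub, mul_sub] at h1
    rw [modularFun_eq, mul_sub]
    exact (sub_smul_eq_sub_iff (squareOp (E.lieDerHom (sharp π α) N) (E.anchor (sharp π α))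
      (E.lieDer_smul (sharp π α)) σ) σ (2 * α (X + sectionY π ψ)) (2 * α (sectionY π ψ))
      (2 * E.interiorPiD π α)).1 h1
  · intro h
    refine ⟨Z - sectionY π ψ, fun α => ?_, by abel⟩
    have h1 := (squareOp_generatorRepresentation hE hS α σ).symm.trans (h α)
    rw [modularFun_eq, mul_sub] at h1
    rw [map_sub, mul_sub]
    exact (sub_smul_eq_sub_iff (squareOp (E.lieDerHom (sharp π α) N) (E.anchor (sharp π α))
      (E.lieDer_smul (sharp π α)) σ) σ (2 * α Z) (2 * α (sectionY π ψ))
      (2 * E.interiorPiD π α)).2 h1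

end LieAlgebroid
end ModularSection

/-! ### Reflexivity and volume forms on a manifold. -/

section Manifold
variable {V : Type*} [NormedAddCommGroup V] [NormedSpace ℝ V]
  {M : Type*} [TopologicalSpace M] [ChartedSpace V M]
  {F : Type*} [NormedAddCommGroup F] [NormedSpace ℝ F]
  {A : M → Type*} [TopologicalSpace (Bundle.TotalSpace F A)] [∀ x, TopologicalSpace (A x)]
  [∀ x, AddCommGroup (A x)] [∀ x, Module ℝ (A x)] [FiberBundle F A] [VectorBundle ℝ F A]
  {N : ℕ}

lemma function_mul_apply (f g : C^∞⟮𝓘(ℝ, V), M; ℝ⟯) (x : M) : (f * g) x = f x * g x := rfl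

/-- A section of the bidual of `A` is given by a section of `A`. -/
lemma exists_section_eq_of_bidual (fr : ∀ p : M, FrameNear (V := V) F A p N)
    (Φ : Module.Dual C^∞⟮𝓘(ℝ, V), M; ℝ⟯
      (Module.Dual C^∞⟮𝓘(ℝ, V), M; ℝ⟯ Cₛ^∞⟮𝓘(ℝ, V); F, A⟯)) :
    ∃ Z : Cₛ^∞⟮𝓘(ℝ, V); F, A⟯, ∀ α, α Z = Φ α := by
  -- The value at `q` uses the frame chosen at `q`, which need not vary continuously. Smoothness
  -- near `p` comes from `key`, which identifies `Z₀` with the smooth section `W p / χ_p` there.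
  let Z₀ : ∀ q : M, A q := fun q => ∑ j, Φ ((fr q).ε j) q • (fr q).e j q
  let W : M → Cₛ^∞⟮𝓘(ℝ, V); F, A⟯ := fun p => ∑ i, Φ ((fr p).ε i) • (fr p).e i
  have key : ∀ p q, (fr p).χ q • Z₀ q = W p q := by
    intro p q
    have h1 : ∀ j, (fr p).χ q • (fr q).e j q =
        ∑ i, (fr p).ε i ((fr q).e j) q • (fr p).e i q := by
      intro j
      have := congrArg (fun s : Cₛ^∞⟮𝓘(ℝ, V); F, A⟯ => s q) ((fr p).smul_eq ((fr q).e j))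
      simp only [section_sum_apply] at this
      exact this
    have h2 : ∀ i, ∑ j, (fr p).ε i ((fr q).e j) q * Φ ((fr q).ε j) q = Φ ((fr p).ε i) q := by
      intro i
      have h3 : ∑ j, (fr p).ε i ((fr q).e j) • (fr q).ε j = (fr q).χ • (fr p).ε i := by
        ext1 s
        rw [LinearMap.smul_apply, ← map_smul, (fr q).smul_eq, map_sum, LinearMap.sum_apply]
        refine Finset.sum_congr rfl fun j _ => ?_
        rw [map_smul, LinearMap.smul_apply, smul_eq_mul, smul_eq_mul, mul_comm]
      have h4 := congrArg (fun f : C^∞⟮𝓘(ℝ, V), M; ℝ⟯ => f q) (congrArg Φ h3)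
      simp only [map_sum, map_smul, smul_eq_mul, function_sum_apply, function_mul_apply,
        (fr q).χ_apply, one_mul] at h4
      exact h4
    change (fr p).χ q • ∑ j, Φ ((fr q).ε j) q • (fr q).e j q = (∑ i, Φ ((fr p).ε i) • (fr p).e i) q
    rw [section_sum_apply, Finset.smul_sum]
    simp only [smul_section_apply, ← h2, Finset.sum_smul]
    rw [Finset.sum_comm]
    refine Finset.sum_congr rfl fun j _ => ?_
    rw [smul_comm, h1, Finset.smul_sum]
    refine Finset.sum_congr rfl fun i _ => ?_
    rw [smul_smul, mul_comm]
  let Z : Cₛ^∞⟮𝓘(ℝ, V); F, A⟯ := ⟨Z₀, fun p => by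
    have hχ : (fr p).χ p ≠ 0 := by rw [(fr p).χ_apply]; exact one_ne_zero
    have hsm : ContMDiffAt 𝓘(ℝ, V) (𝓘(ℝ, V).prod 𝓘(ℝ, F)) ∞
        (fun x => (⟨x, ((fr p).χ x)⁻¹ • W p x⟩ : Bundle.TotalSpace F A)) p :=
      ((fr p).χ.contMDiff.contMDiffAt.inv₀ hχ).smul_section ((W p).contMDiff p)
    refine hsm.congr_of_eventuallyEq ?_
    filter_upwards [(fr p).χ.contMDiff.continuous.continuousAt.eventually_ne hχ] with x hx
    rw [← key, smul_smul, inv_mul_cancel₀ hx, one_smul]⟩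
  refine ⟨Z, fun α => ?_⟩
  ext p
  have h1 : (fr p).χ • Z = ∑ i, Φ ((fr p).ε i) • (fr p).e i := by
    ext q; exact key p q
  have h2 : (fr p).χ * α Z = (fr p).χ * Φ α := by
    rw [← smul_eq_mul, ← map_smul, h1, map_sum, ← smul_eq_mul, ← map_smul]
    have h3 : (fr p).χ • α = ∑ i, α ((fr p).e i) • (fr p).ε i := by
      ext1 s
      rw [LinearMap.smul_apply, ← map_smul, (fr p).smul_eq, map_sum, LinearMap.sum_apply]
      refine Finset.sum_congr rfl fun j _ => ?_
      rw [map_smul, LinearMap.smul_apply, smul_eq_mul, smul_eq_mul, mul_comm]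
    rw [h3, map_sum]
    refine Finset.sum_congr rfl fun j _ => ?_
    rw [map_smul, map_smul, smul_eq_mul, smul_eq_mul, mul_comm]
  have h4 := congrArg (fun f : C^∞⟮𝓘(ℝ, V), M; ℝ⟯ => f p) h2
  simpa only [function_mul_apply, (fr p).χ_apply, one_mul] using h4

lemma hasLocalFrames (fr : ∀ p : M, FrameNear (V := V) F A p N) :
    HasLocalFrames C^∞⟮𝓘(ℝ, V), M; ℝ⟯ Cₛ^∞⟮𝓘(ℝ, V); F, A⟯ N where
  reflexive := by
    refine ⟨fun s s' h => ?_, fun Φ => ?_⟩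
    · ext p
      have h1 : ∀ α : Module.Dual C^∞⟮𝓘(ℝ, V), M; ℝ⟯ Cₛ^∞⟮𝓘(ℝ, V); F, A⟯, α s = α s' :=
        fun α => congrArg (fun G => G α) h
      have h2 : (fr p).χ • s = (fr p).χ • s' := by
        rw [(fr p).smul_eq, (fr p).smul_eq]; simp only [h1]
      have h3 := congrArg (fun s : Cₛ^∞⟮𝓘(ℝ, V); F, A⟯ => s p) h2
      simpa only [smul_section_apply, (fr p).χ_apply, one_smul] using h3
    · obtain ⟨Z, hZ⟩ := exists_section_eq_of_bidual fr Φ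
      exact ⟨Z, LinearMap.ext hZ⟩
  separating c h := by
    ext p
    obtain ⟨k, hk⟩ := h (fr p).χ (fr p).e (fr p).ε (fr p).smul_eq
    have h1 := congrArg (fun f : C^∞⟮𝓘(ℝ, V), M; ℝ⟯ => f p) hk
    simp only [function_mul_apply, ContMDiffMap.coe_pow, Pi.pow_apply, (fr p).χ_apply, one_pow,
      one_mul] at h1
    exact h1

/-- At `p` both top forms are multiples of one determinant. Hence the ratio of two top forms does
not depend on the sections on which they are evaluated. -/
lemma form_mul_form_comm (fr : ∀ p : M, FrameNear (V := V) F A p N)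
    (η μ : Form C^∞⟮𝓘(ℝ, V), M; ℝ⟯ Cₛ^∞⟮𝓘(ℝ, V); F, A⟯ N)
    (a b : Fin N → Cₛ^∞⟮𝓘(ℝ, V); F, A⟯) (p : M) : η a p * μ b p = η b p * μ a p := by
  have h : ∀ (ζ : Form C^∞⟮𝓘(ℝ, V), M; ℝ⟯ Cₛ^∞⟮𝓘(ℝ, V); F, A⟯ N)
      (a : Fin N → Cₛ^∞⟮𝓘(ℝ, V); F, A⟯), ζ a p =
      ζ (fr p).e p * (Matrix.of fun i j => (fr p).ε i (a j)).det p := by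
    intro ζ a
    have h1 := congrArg (fun f : C^∞⟮𝓘(ℝ, V), M; ℝ⟯ => f p)
      (form_apply_eq_det (fr p).smul_eq ζ a)
    simpa only [function_mul_apply, ContMDiffMap.coe_pow, Pi.pow_apply, (fr p).χ_apply, one_pow,
      one_mul] using h1
  rw [h η a, h μ b, h η b, h μ a]; ring

/-- Volume forms are the sections of `∧^N A^*` which generate the module of all sections. -/
lemma isVolumeForm_iff_isFrame (fr : ∀ p : M, FrameNear (V := V) F A p N)
    (μ : Form C^∞⟮𝓘(ℝ, V), M; ℝ⟯ Cₛ^∞⟮𝓘(ℝ, V); F, A⟯ N) :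
    IsVolumeForm μ ↔ IsFrame C^∞⟮𝓘(ℝ, V), M; ℝ⟯ μ := by
  constructor
  · intro hμ
    refine ⟨fun f g h => ?_, fun η => ?_⟩
    · ext p
      obtain ⟨a, ha⟩ := hμ p
      have h1 := congrArg (fun f : C^∞⟮𝓘(ℝ, V), M; ℝ⟯ => f p)
        (congrArg (fun ν : Form C^∞⟮𝓘(ℝ, V), M; ℝ⟯ Cₛ^∞⟮𝓘(ℝ, V); F, A⟯ N => ν a) h)
      exact mul_right_cancel₀ ha h1
    · choose a ha using hμ
      -- The ratio `η / μ`. The choice `a q` may jump with `q`, but near `p` it can be replaced by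
      -- the fixed tuple `a p`.
      let f : C^∞⟮𝓘(ℝ, V), M; ℝ⟯ := ⟨fun q => η (a q) q * (μ (a q) q)⁻¹, fun p => by
        have hsm : ContMDiffAt 𝓘(ℝ, V) 𝓘(ℝ, ℝ) ∞ (fun q => η (a p) q * (μ (a p) q)⁻¹) p :=
          (η (a p)).contMDiff.contMDiffAt.mul ((μ (a p)).contMDiff.contMDiffAt.inv₀ (ha p))
        refine hsm.congr_of_eventuallyEq ?_
        filter_upwards [(μ (a p)).contMDiff.continuous.continuousAt.eventually_ne (ha p)] with q hq
        rw [← div_eq_mul_inv, ← div_eq_mul_inv, div_eq_div_iff (ha q) hq]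
        exact form_mul_form_comm fr η μ _ _ q⟩
      refine ⟨f, ?_⟩
      ext b q
      change η (a q) q * (μ (a q) q)⁻¹ * μ b q = η b q
      rw [mul_right_comm, form_mul_form_comm fr η μ, mul_assoc, mul_inv_cancel₀ (ha q), mul_one]
  · intro hμ p
    -- The form `ε₁ ∧ … ∧ ε_N` has value 1 on the frame at `p`; being a multiple of `μ`, it forces
    -- `μ(e)(p) ≠ 0`.
    obtain ⟨f, hf⟩ := hμ.2 (evalForm (exteriorPower.ιMulti _ N (fr p).ε))
    refine ⟨(fr p).e, fun h0 => ?_⟩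
    have h1 := congrArg (fun f : C^∞⟮𝓘(ℝ, V), M; ℝ⟯ => f p)
      (congrArg (fun ν : Form C^∞⟮𝓘(ℝ, V), M; ℝ⟯ Cₛ^∞⟮𝓘(ℝ, V); F, A⟯ N => ν (fr p).e) hf)
    simp only [AlternatingMap.smul_apply, smul_eq_mul, function_mul_apply, h0, mul_zero,
      evalForm_ιMulti] at h1
    have h2 := (ContMDiffMap.evalRingHom p : C^∞⟮𝓘(ℝ, V), M; ℝ⟯ →+* ℝ).map_det
      (Matrix.of fun i j => (fr p).ε j ((fr p).e i))
    have h3 : (ContMDiffMap.evalRingHom p : C^∞⟮𝓘(ℝ, V), M; ℝ⟯ →+* ℝ).mapMatrix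
      (Matrix.of fun i j => (fr p).ε j ((fr p).e i)) = 1 := by
      ext i j
      change (fr p).ε j ((fr p).e i) p = _
      rw [(fr p).ε_apply, Matrix.one_apply]
      simp only [eq_comm]
    rw [h3, Matrix.det_one] at h2
    exact zero_ne_one (h1.trans h2)

end Manifold
end TwistedPoisson

theorem mainTheorem11
    {V : Type*} [NormedAddCommGroup V] [NormedSpace ℝ V] [FiniteDimensional ℝ V]
    {M : Type*} [TopologicalSpace M] [ChartedSpace V M] [IsManifold 𝓘(ℝ, V) ∞ M]
    [T2Space M] [SigmaCompactSpace M]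
    {F : Type*} [NormedAddCommGroup F] [NormedSpace ℝ F] [FiniteDimensional ℝ F]
    {A : M → Type*} [TopologicalSpace (Bundle.TotalSpace F A)] [∀ x, TopologicalSpace (A x)]
    [∀ x, AddCommGroup (A x)] [∀ x, Module ℝ (A x)] [FiberBundle F A] [VectorBundle ℝ F A]
    [ContMDiffVectorBundle ∞ F A 𝓘(ℝ, V)]
    (E : LieAlgebroid C^∞⟮𝓘(ℝ, V), M; ℝ⟯ Cₛ^∞⟮𝓘(ℝ, V); F, A⟯)
    (π : ⋀[C^∞⟮𝓘(ℝ, V), M; ℝ⟯]^2 Cₛ^∞⟮𝓘(ℝ, V); F, A⟯)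
    (ψ : ⋀[C^∞⟮𝓘(ℝ, V), M; ℝ⟯]^3
      (Module.Dual C^∞⟮𝓘(ℝ, V), M; ℝ⟯ Cₛ^∞⟮𝓘(ℝ, V); F, A⟯))
    (hE : E.IsTwistedPoisson π ψ) :
    ∃ (Edual : LieAlgebroid C^∞⟮𝓘(ℝ, V), M; ℝ⟯
          (Module.Dual C^∞⟮𝓘(ℝ, V), M; ℝ⟯ Cₛ^∞⟮𝓘(ℝ, V); F, A⟯))
      (R : Representation Edual
          (Form C^∞⟮𝓘(ℝ, V), M; ℝ⟯ Cₛ^∞⟮𝓘(ℝ, V); F, A⟯ (Module.finrank ℝ F))),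
      (∀ α, Edual.anchor α = E.anchor (sharp π α)) ∧
      (∀ α β, Edual.bracket α β = E.dualBracket π ψ α β) ∧
      (∀ α μ, R.D α μ = E.generatorRep π ψ α μ) ∧
      (∃ c, IsModularClass (Module.finrank ℝ F) E π ψ Edual c) ∧
      ∀ c, IsModularClass (Module.finrank ℝ F) E π ψ Edual c ↔ R.IsCharacteristicClass c := by
  have fr : ∀ p : M, FrameNear (V := V) F A p (Module.finrank ℝ F) :=
    fun p => Classical.choice (nonempty_frameNear p)
  have hS := hasLocalFrames fr
  let R := E.generatorRepresentation hE hS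
  have hiff : ∀ c, IsModularClass (Module.finrank ℝ F) E π ψ (E.dualAlgebroid hE hS) c ↔
      R.IsCharacteristicClass c := by
    intro c
    constructor
    · rintro ⟨h1, h2⟩
      refine ⟨fun μ hμ => ?_, fun σ hσ => ?_⟩
      · obtain ⟨Z, hZ, hX, hc⟩ := h1 μ ((isVolumeForm_iff_isFrame fr μ).2 hμ)
        exact ⟨⟨_, hZ⟩, (LieAlgebroid.isModularSection_iff hE hS μ Z).1 hX, hc⟩
      · obtain ⟨Z, hZ, hX, hc⟩ := h2 σ hσ
        -- The square of the line bundle has cocycle `2Z`; the factor `1/2` in the characteristic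
        -- class undoes this.
        refine ⟨(2 : ℝ) • ⟨_, hZ⟩, fun α => ?_, ?_⟩
        · refine ((LieAlgebroid.isModularSectionDensity_iff hE hS σ Z).1 hX α).trans ?_
          change _ = ((2 : ℝ) • α Z) • σ
          rw [two_smul, two_mul]
        · rw [hc]
          change _ = (1 / 2 : ℝ) • ((2 : ℝ) • LieAlgebroid.classOf _ _)
          rw [smul_smul]; norm_num
    · rintro ⟨h1, h2⟩
      refine ⟨fun μ hμ => ?_, fun σ hσ => ?_⟩
      · obtain ⟨⟨θ, hθ⟩, hD, hc⟩ := h1 μ ((isVolumeForm_iff_isFrame fr μ).1 hμ)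
        -- Reflexivity: a 1-form on the Lie algebroid `A^*` is evaluation at a section of `A`.
        obtain ⟨Z, rfl⟩ := hS.reflexive.2 θ
        exact ⟨Z, hθ, (LieAlgebroid.isModularSection_iff hE hS μ Z).2 hD, hc⟩
      · obtain ⟨θ, hD, hc⟩ := h2 σ hσ
        obtain ⟨θ', rfl⟩ : ∃ θ' : (E.dualAlgebroid hE hS).cocycles, θ = (2 : ℝ) • θ' :=
          ⟨(1 / 2 : ℝ) • θ, by rw [smul_smul]; norm_num⟩
        obtain ⟨θ', hθ'⟩ := θ'
        obtain ⟨Z, rfl⟩ := hS.reflexive.2 θ'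
        refine ⟨Z, hθ', (LieAlgebroid.isModularSectionDensity_iff hE hS σ Z).2 fun α => ?_, ?_⟩
        · refine (hD α).trans ?_
          change ((2 : ℝ) • α Z) • σ = _
          rw [two_smul, two_mul]
        · rw [hc]
          change (1 / 2 : ℝ) • ((2 : ℝ) • LieAlgebroid.classOf _ _) = _
          rw [smul_smul]; norm_num
  refine ⟨E.dualAlgebroid hE hS, R, fun _ => rfl, fun _ _ => rfl, fun _ _ => rfl, ?_, hiff⟩
  -- A single class valid for every volume form and every density expresses both the closedness of
  -- `Z` and the independence of `λ`; it is transported from the characteristic class.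
  obtain ⟨c, hc⟩ := R.exists_isCharacteristicClass exists_logarithmic_primitive
  exact ⟨c, (hiff c).2 hc⟩
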